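/- Conventions. A rooted map of size $n$ is a connected planar graph with $n$ edges (loops and multiple edges allowed), embedded in the oriented sphere so that all faces are discs, together with a root, which is a dangling half-edge attached to a vertex (the root-vertex) inside a face (the root-face); it is considered up to orientation-preserving homeomorphism. Equivalently, it is a set of $2n+1$ half-edges with a permutation $\sigma$ (next half-edge counterclockwise around the vertex) and an involution $\alpha$ (other half of the edge) fixing only the root, connected and satisfying Euler's relation for the sphere, up to relabelling. A tree is a rooted map with a single face. The tour of a tree follows its border from the root in counterclockwise direction; it orders the vertices by their first appearance and meets every corner (a corner being a pair of consecutive half-edges around a vertex); the first corner of a vertex is the first of its corners met by the tour. A non-crossing partition of size $m$ is an equivalence relation $\sim$ on $\{1,\dots,m\}$ for which there are no $a<b<c<d$ with $a\sim c$, $b\sim d$, $a\not\sim b$. In an oriented map each edge from $u$ to $v$ consists of a tail, incident to $u$, and a head, incident to $v$; the root is also a head. A positive cycle is a directed simple cycle (possibly a loop) such that the root-face lies in the region of the sphere situated at its right. A tree-oriented map is an oriented rooted map without positive cycle in which every vertex can be reached from the root-vertex by a directed path. Vertex explosion $\varphi=(\varphi_0,\varphi_1)$. Given a tree-oriented map $\vec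 M$ of size $n$, replace each vertex $v$ by as many vertices as there are heads incident to $v$: each head $h$ at $v$ gives one vertex, to which remain attached $h$ and those tails $t$ at $v$ for which $h$ is the first head encountered counterclockwise around $v$ starting from $t$, in the cyclic order inherited from $v$. Let $\varphi_0(\vec M)$ be the resulting unoriented rooted object. Number its vertices $1,\dots,n+1$ in the order of appearance, and let $\varphi_1(\vec M)$ be the relation on $\{1,\dots,n+1\}$ for which two vertices are equivalent if they come from the same vertex of $\vec M$. Gluing $\psi$. Given a tree $T$ of size $n$ and a non-crossing partition $\sim$ of size $n+1$, identify $\{1,\dots,n+1\}$ with the vertices of $T$ in order of appearance and orient $T$ from the root to the leaves. For each part $\{v_1<\dots<v_k\}$ glue the first corners of $v_1,\dots,v_k$ into one cell (the cells being disjoint) and contract the cell to one vertex. That is, counterclockwise around the new vertex one finds the half-edges of $v_k, v_{k-1},\dots,v_1$ in turn, those of each $v_i$ being listed counterclockwise from its first corner. Let $\psi(T,\sim)$ be the resulting oriented map. Statement. For every $n\ge 0$: (1) for every tree-oriented map $\vec M$ of size $n$, $\varphi_0(\vec M)$ is a tree of size $n$ and $\varphi_1(\vec M)$ is a non-crossing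 partition of size $n+1$; (2) for every tree $T$ of size $n$ and every non-crossing partition $\sim$ of size $n+1$, $\psi(T,\sim)$ is a tree-oriented map of size $n$; (3) $\vec M\mapsto(\varphi_0(\vec M),\varphi_1(\vec M))$ is a well-defined bijection from the set of tree-oriented maps of size $n$ onto the set of pairs consisting of a tree of size $n$ and a non-crossing partition of size $n+1$, and its inverse is $\psi$. -/

import Mathlib

/-- For a permutation `π` of a finite set and an equivalence relation `r`, the permutation
`x ↦ π^k x`, where `k ≥ 1` is least with `π^k x` equivalent to `x`.  It keeps, inside each class
of `r`, the cyclic orders of the cycles of `π`. -/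
noncomputable def inducedFun {H : Type*} (π : Equiv.Perm H) (r : Setoid H) (x : H) : H :=
  (π ^ sInf {k : ℕ | 0 < k ∧ r x ((π ^ k) x)}) x

theorem inducedFun_spec {H : Type*} [Finite H] (π : Equiv.Perm H) (r : Setoid H) (x : H) :
    ∃ k : ℕ, 0 < k ∧ r x ((π ^ k) x) ∧ inducedFun π r x = (π ^ k) x ∧
      ∀ m : ℕ, 0 < m → r x ((π ^ m) x) → k ≤ m := by
  have hne : {k : ℕ | 0 < k ∧ r x ((π ^ k) x)}.Nonempty :=
    ⟨orderOf π, orderOf_pos π, by simp [pow_orderOf_eq_one]⟩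
  have hm := Nat.sInf_mem hne
  exact ⟨_, hm.1, hm.2, rfl, fun m h1 h2 => Nat.sInf_le ⟨h1, h2⟩⟩

theorem inducedFun_injective {H : Type*} [Finite H] (π : Equiv.Perm H) (r : Setoid H) :
    Function.Injective (inducedFun π r) := by
  have key : ∀ (x y : H) (k l : ℕ), 0 < k → k ≤ l → r x ((π ^ k) x) → r y ((π ^ l) y) →
      (π ^ k) x = (π ^ l) y → (∀ m : ℕ, 0 < m → r y ((π ^ m) y) → l ≤ m) → x = y := by
    intro x y k l hk hkl hx hy he hmin
    have hxy : x = (π ^ (l - k)) y := by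
      apply (π ^ k).injective
      rw [he, ← Equiv.Perm.mul_apply, ← pow_add, Nat.add_sub_cancel' hkl]
    rcases Nat.eq_zero_or_pos (l - k) with h0 | h0
    · simpa [h0] using hxy
    · have hr : r y ((π ^ (l - k)) y) := by
        rw [← hxy]
        exact r.trans' hy (r.symm' (he ▸ hx))
      have := hmin _ h0 hr
      omega
  intro x y h
  obtain ⟨k, hk, hkr, hke, hkm⟩ := inducedFun_spec π r x
  obtain ⟨l, hl, hlr, hle, hlm⟩ := inducedFun_spec π r y
  have he : (π ^ k) x = (π ^ l) y := by rw [← hke, ← hle, h]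
  rcases le_total k l with hkl | hkl
  · exact key x y k l hk hkl hkr hlr he hlm
  · exact (key y x l k hl hkl hlr hkr he.symm hkm).symm

/-- `inducedFun π r` as a permutation. -/
noncomputable def inducedPerm {H : Type*} [Finite H] (π : Equiv.Perm H) (r : Setoid H) :
    Equiv.Perm H :=
  Equiv.ofBijective (inducedFun π r)
    (Finite.injective_iff_bijective.mp (inducedFun_injective π r))

/-- An equivalence relation on a linearly ordered set is non-crossing if no `a < b < c < d` satisfy
`a ∼ c`, `b ∼ d` and `a ≁ b`. -/
def IsNonCrossing {S : Type*} [LinearOrder S] (s : Setoid S) : Prop :=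
  ¬ ∃ a b c d : S, a < b ∧ b < c ∧ c < d ∧ s a c ∧ s b d ∧ ¬ s a b

/-- Non-crossing partitions of size `m`. -/
def NonCrossingPartition (m : ℕ) : Type :=
  {s : Setoid (Fin m) // IsNonCrossing s}

/-- The half-edge description of a rooted graph with `n` edges drawn on an oriented surface.  There
are `2 * n` half-edges belonging to edges, and one more, the root, which is a dangling half-edge.
`σ h` is the half-edge following `h` in counterclockwise direction around the vertex incident to
`h`; `α h` is the other half of the edge of `h`, and the root alone has no other half. -/
structure RotationSystem (n : ℕ) where
  σ : Equiv.Perm (Fin (2 * n + 1))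
  α : Equiv.Perm (Fin (2 * n + 1))
  root : Fin (2 * n + 1)
  α_α : ∀ h, α (α h) = h
  α_eq_self_iff : ∀ h, α h = h ↔ h = root

namespace RotationSystem

variable {n : ℕ}

/-- Vertices are the cycles of `σ`. -/
def Vertex (M : RotationSystem n) : Type :=
  Quotient (Equiv.Perm.SameCycle.setoid M.σ)

/-- The vertex incident to a half-edge. -/
def vertex (M : RotationSystem n) (h : Fin (2 * n + 1)) : M.Vertex :=
  Quotient.mk (Equiv.Perm.SameCycle.setoid M.σ) h

/-- One follows `h` from its vertex to the other end of its edge, along the right side, and gets to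
the next half-edge on the border of the face at the right of `h`. The root is followed to its
dangling end and back. -/
def facePerm (M : RotationSystem n) : Equiv.Perm (Fin (2 * n + 1)) :=
  M.σ * M.α

/-- Faces are the cycles of `facePerm`; the cycle of `h` is the face lying at the right of `h`
when `h` is traversed starting from its vertex. -/
def Face (M : RotationSystem n) : Type :=
  Quotient (Equiv.Perm.SameCycle.setoid M.facePerm)

/-- A rooted planar map: connected, and of genus `0` by Euler's relation `V - E + F = 2`. -/
structure IsMap (M : RotationSystem n) : Prop where
  connected : ∀ x y, ∃ g ∈ Subgroup.closure {M.σ, M.α}, g x = y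
  euler : Nat.card M.Vertex + Nat.card M.Face = n + 2

/-- A planted plane tree: a rooted map with a single face. -/
structure IsTree (T : RotationSystem n) : Prop where
  isMap : T.IsMap
  card_face : Nat.card T.Face = 1

/-- Equality of rooted maps up to orientation preserving homeomorphism: relabelling of the
half-edges. -/
def Iso (M M' : RotationSystem n) : Prop :=
  ∃ e : Equiv.Perm (Fin (2 * n + 1)),
    (∀ h, e (M.σ h) = M'.σ (e h)) ∧ (∀ h, e (M.α h) = M'.α (e h)) ∧ e M.root = M'.root

theorem Iso.refl (M : RotationSystem n) : M.Iso M :=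
  ⟨1, by simp, by simp, by simp⟩

theorem Iso.symm {M M' : RotationSystem n} (h : M.Iso M') : M'.Iso M := by
  obtain ⟨e, h1, h2, h3⟩ := h
  refine ⟨e.symm, fun x => ?_, fun x => ?_, ?_⟩
  · rw [Equiv.symm_apply_eq, h1, Equiv.apply_symm_apply]
  · rw [Equiv.symm_apply_eq, h2, Equiv.apply_symm_apply]
  · rw [Equiv.symm_apply_eq, h3]

theorem Iso.trans {M M' M'' : RotationSystem n} (h : M.Iso M') (h' : M'.Iso M'') :
    M.Iso M'' := by
  obtain ⟨e, h1, h2, h3⟩ := h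
  obtain ⟨f, g1, g2, g3⟩ := h'
  exact ⟨f * e, fun x => by simp [h1, g1], fun x => by simp [h2, g2], by simp [h3, g3]⟩

/-- The tour starting at the root (border in counterclockwise direction: each edge is followed with
the tree on the left).  The `j`-th corner met is the one between the half-edge `T.corner j` and the
next half-edge `T.σ (T.corner j)` in counterclockwise direction. A corner is
represented by the first of these two half-edges. -/
def corner (T : RotationSystem n) (j : ℕ) : Fin (2 * n + 1) :=
  T.α ((T.facePerm ^ j) T.root)

/-- The `j`-th corner of the tour is the first one met at its vertex. -/
def IsFirstVisit (T : RotationSystem n) (j : ℕ) : Prop :=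
  ∀ i < j, T.vertex (T.corner i) ≠ T.vertex (T.corner j)

/-- The first corner of the `i`-th vertex (`i = 0, …, n`) in order of appearance. -/
noncomputable def firstCorner (T : RotationSystem n) (i : Fin (n + 1)) : Fin (2 * n + 1) :=
  T.corner (Nat.nth T.IsFirstVisit i)

/-- The `i`-th vertex (`i = 0, …, n`) in order of appearance. -/
noncomputable def nthVertex (T : RotationSystem n) (i : Fin (n + 1)) : T.Vertex :=
  T.vertex (T.firstCorner i)

/-- In a tree with `n` edges the order of appearance identifies `Fin (n + 1)` with the set of
vertices. -/
theorem IsTree.nthVertex_bijective {T : RotationSystem n} (hT : T.IsTree) :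
    Function.Bijective T.nthVertex := by
  have hfin : Finite T.Vertex := Quotient.finite _
  have hcard : Nat.card T.Vertex = n + 1 := by
    have h1 := hT.isMap.euler
    have h2 := hT.card_face
    omega
  have hsub : Subsingleton T.Face := (Nat.card_eq_one_iff_unique.mp hT.card_face).1
  have hvis : ∀ x, ∃ j : ℕ, T.corner j = x := by
    intro x
    have hs : T.facePerm.SameCycle T.root (T.α x) :=
      Quotient.exact (s := Equiv.Perm.SameCycle.setoid T.facePerm) (Subsingleton.elim (α := T.Face)
        (Quotient.mk (Equiv.Perm.SameCycle.setoid T.facePerm) T.root)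
        (Quotient.mk (Equiv.Perm.SameCycle.setoid T.facePerm) (T.α x)))
    obtain ⟨j, hj⟩ := hs.exists_nat_pow_eq
    exact ⟨j, by rw [corner, hj, T.α_α]⟩
  have hinj : Set.InjOn (fun j => T.vertex (T.corner j)) {j | T.IsFirstVisit j} := by
    intro i hi j hj hij
    rcases lt_trichotomy i j with h | h | h
    · exact absurd hij (hj i h)
    · exact h
    · exact absurd hij.symm (hi j h)
  have hsurj : ∀ v : T.Vertex, ∃ j, T.IsFirstVisit j ∧ T.vertex (T.corner j) = v := by
    classical
    intro v
    obtain ⟨x, rfl⟩ : ∃ x, T.vertex x = v := Quotient.exists_rep v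
    obtain ⟨j, hj⟩ := hvis x
    have hex : ∃ j, T.vertex (T.corner j) = T.vertex x := ⟨j, by rw [hj]⟩
    refine ⟨Nat.find hex, fun i hi => ?_, Nat.find_spec hex⟩
    rw [Nat.find_spec hex]
    exact Nat.find_min hex hi
  have hF : {j | T.IsFirstVisit j}.Finite := Set.Finite.of_finite_image (Set.toFinite _) hinj
  have hc : hF.toFinset.card = n + 1 := by
    rw [← hcard, ← Set.ncard_eq_toFinset_card _ hF, ← hinj.ncard_image,
      ← Set.ncard_univ]
    congr 1
    ext v
    simpa using hsurj v
  have hi : Function.Injective T.nthVertex := by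
    intro i j hij
    have hmem : ∀ i : Fin (n + 1), T.IsFirstVisit (Nat.nth T.IsFirstVisit i) := fun i =>
      Nat.nth_mem (i : ℕ) (fun hf => by
        have : hf.toFinset = hF.toFinset := rfl
        rw [this, hc]; exact i.2)
    have h := hinj (hmem i) (hmem j) hij
    have h' := Nat.nth_injOn hF (x₁ := (i : ℕ)) (x₂ := (j : ℕ))
      (by rw [Set.mem_Iio, hc]; exact i.2)
      (by rw [Set.mem_Iio, hc]; exact j.2) h
    exact Fin.ext h'
  have : Nat.card (Fin (n + 1)) = Nat.card T.Vertex := by rw [hcard, Nat.card_fin]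
  exact (Nat.bijective_iff_injective_and_card _).mpr ⟨hi, this⟩

theorem IsTree.firstCorner_injective {T : RotationSystem n} (hT : T.IsTree) :
    Function.Injective T.firstCorner := fun _ _ h =>
  hT.nthVertex_bijective.1 (congrArg T.vertex h)

/-- The underlying graph (loops and multiplicities forgotten), used for distances. -/
def graph (M : RotationSystem n) : SimpleGraph M.Vertex :=
  SimpleGraph.fromRel fun u v => ∃ h, M.vertex h = u ∧ M.vertex (M.α h) = v

/-- Distance from the root-vertex. -/
noncomputable def depth (M : RotationSystem n) (v : M.Vertex) : ℕ :=
  M.graph.dist (M.vertex M.root) v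

end RotationSystem

/-- A rotation system with a set of half-edges called heads; the other half-edges are tails. -/
structure OrientedSystem (n : ℕ) extends RotationSystem n where
  isHead : Fin (2 * n + 1) → Prop

namespace OrientedSystem

variable {n : ℕ}

/-- Each edge has one head and one tail, and the root is a head. -/
structure IsOriented (M : OrientedSystem n) : Prop where
  root_isHead : M.isHead M.root
  isHead_α : ∀ h, h ≠ M.root → (M.isHead (M.α h) ↔ ¬ M.isHead h)

/-- There is an edge oriented from `u` to `v`. -/
def Arc (M : OrientedSystem n) (u v : M.Vertex) : Prop :=
  ∃ t, ¬ M.isHead t ∧ M.vertex t = u ∧ M.vertex (M.α t) = v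

/-- The edges with tails `c 0, …, c k` form, in this cyclic order, a directed simple cycle (a loop
if `k = 0`); the index `i + 1` is taken modulo `k + 1`. -/
structure IsDirectedCycle (M : OrientedSystem n) {k : ℕ} (c : Fin (k + 1) → Fin (2 * n + 1)) :
    Prop where
  tail : ∀ i, ¬ M.isHead (c i)
  consecutive : ∀ i, M.vertex (M.α (c i)) = M.vertex (c (i + 1))
  simple : Function.Injective fun i => M.vertex (c i)

/-- `x` and `y` stand for the faces at the right of the half-edges `x` and `y`. The faces are the
same, or one goes from one to the other by crossing an edge which is not in the cycle `c`. -/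
def AvoidStep (M : OrientedSystem n) {k : ℕ} (c : Fin (k + 1) → Fin (2 * n + 1))
    (x y : Fin (2 * n + 1)) : Prop :=
  y = M.facePerm x ∨ (y = M.α x ∧ ∀ i, x ≠ c i ∧ x ≠ M.α (c i))

/-- The root lies in the exterior region of the directed cycle `c`, that is, the region at its
right: from a face at the right of an edge of `c` one gets to the root-face without crossing `c`. -/
def RootInExterior (M : OrientedSystem n) {k : ℕ} (c : Fin (k + 1) → Fin (2 * n + 1)) : Prop :=
  ∃ i, Relation.EqvGen (M.AvoidStep c) (c i) M.root

/-- A tree-oriented map: an oriented rooted planar map without positive cycle (a directed simple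
cycle with the root in its exterior region) such that every vertex can be reached from the root by
a directed path. -/
structure IsTreeOriented (M : OrientedSystem n) : Prop where
  isMap : M.IsMap
  isOriented : M.IsOriented
  reachable : ∀ v, Relation.ReflTransGen M.Arc (M.vertex M.root) v
  no_positive_cycle : ∀ (k : ℕ) (c : Fin (k + 1) → Fin (2 * n + 1)),
    M.IsDirectedCycle c → ¬ M.RootInExterior c

/-- Equality of oriented rooted maps up to relabelling of the half-edges. -/
def Iso (M M' : OrientedSystem n) : Prop :=
  ∃ e : Equiv.Perm (Fin (2 * n + 1)),
    (∀ h, e (M.σ h) = M'.σ (e h)) ∧ (∀ h, e (M.α h) = M'.α (e h)) ∧ e M.root = M'.root ∧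
      ∀ h, M'.isHead (e h) ↔ M.isHead h

theorem Iso.refl (M : OrientedSystem n) : M.Iso M :=
  ⟨1, by simp, by simp, by simp, by simp⟩

theorem Iso.symm {M M' : OrientedSystem n} (h : M.Iso M') : M'.Iso M := by
  obtain ⟨e, h1, h2, h3, h4⟩ := h
  refine ⟨e.symm, fun x => ?_, fun x => ?_, ?_, fun x => ?_⟩
  · rw [Equiv.symm_apply_eq, h1, Equiv.apply_symm_apply]
  · rw [Equiv.symm_apply_eq, h2, Equiv.apply_symm_apply]
  · rw [Equiv.symm_apply_eq, h3]
  · rw [← h4, Equiv.apply_symm_apply]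

theorem Iso.trans {M M' M'' : OrientedSystem n} (h : M.Iso M') (h' : M'.Iso M'') :
    M.Iso M'' := by
  obtain ⟨e, h1, h2, h3, h4⟩ := h
  obtain ⟨f, g1, g2, g3, g4⟩ := h'
  exact ⟨f * e, fun x => by simp [h1, g1], fun x => by simp [h2, g2], by simp [h3, g3],
    fun x => by simp [g4, h4]⟩

/-- The first head encountered in counterclockwise direction around the vertex of `x`, starting
from `x` (`x` itself if it is a head). -/
noncomputable def firstHead (M : OrientedSystem n) (x : Fin (2 * n + 1)) : Fin (2 * n + 1) :=
  (M.σ ^ sInf {k : ℕ | M.isHead ((M.σ ^ k) x)}) x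

/-- The map `φ₀`, vertex explosion: two half-edges at a vertex stay adjacent iff they have the same
first head, and they keep their cyclic order.  The edges and the root do not change, and the
orientation is forgotten. -/
noncomputable def explode (M : OrientedSystem n) : RotationSystem n where
  σ := inducedPerm M.σ (Setoid.ker M.firstHead)
  α := M.α
  root := M.root
  α_α := M.α_α
  α_eq_self_iff := M.α_eq_self_iff

/-- The map `φ₁`: the vertices of the exploded map are numbered in order of appearance, and two of
them are equivalent if they come from the same vertex of `M`. -/
noncomputable def explosionPartition (M : OrientedSystem n) : Setoid (Fin (n + 1)) :=
  Setoid.ker fun i => M.vertex (M.explode.firstCorner i)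

end OrientedSystem

namespace RotationSystem

variable {n : ℕ}

/-- The map `ψ`, for a tree `T` and an equivalence relation `s` on its vertices, numbered in order
of appearance.  `T` is oriented from the root to the leaves.  For each part of `s`, a cell is glued
to the first corners of its vertices and is contracted to a single vertex.  Seen from the cell,
which lies in the outer face, the corners come in clockwise direction in the order of appearance;
hence in counterclockwise direction around the contracted vertex the half-edges of the `i`-th
vertex of `T`, which end with `firstCorner i`, are followed by those of the `j`-th one, starting
after `firstCorner j`, where `j` is the element of the part of `i` that cyclically precedes `i`. -/
noncomputable def glue (T : RotationSystem n) (hT : T.IsTree) (s : Setoid (Fin (n + 1))) :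
    OrientedSystem n where
  σ := T.σ * Equiv.Perm.viaEmbedding (inducedPerm (finRotate (n + 1))⁻¹ s)
    ⟨T.firstCorner, hT.firstCorner_injective⟩
  α := T.α
  root := T.root
  α_α := T.α_α
  α_eq_self_iff := T.α_eq_self_iff
  isHead h := h = T.root ∨ T.depth (T.vertex (T.α h)) < T.depth (T.vertex h)

end RotationSystem

/-- Identification of isomorphic trees. -/
def treeSetoid (n : ℕ) : Setoid {T : RotationSystem n // T.IsTree} where
  r T T' := T.1.Iso T'.1
  iseqv := ⟨fun _ => .refl _, fun h => h.symm, fun h h' => h.trans h'⟩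

/-- Planted plane trees of size `n`. -/
def PlaneTree (n : ℕ) : Type := Quotient (treeSetoid n)

/-- The planted plane tree with a given half-edge description. -/
def PlaneTree.mk {n : ℕ} (T : RotationSystem n) (hT : T.IsTree) : PlaneTree n :=
  Quotient.mk (treeSetoid n) ⟨T, hT⟩

/-- Identification of isomorphic tree-oriented maps. -/
def treeOrientedSetoid (n : ℕ) : Setoid {M : OrientedSystem n // M.IsTreeOriented} where
  r M M' := M.1.Iso M'.1
  iseqv := ⟨fun _ => .refl _, fun h => h.symm, fun h h' => h.trans h'⟩

/-- Tree-oriented maps of size `n`. -/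
def TreeOrientedMap (n : ℕ) : Type := Quotient (treeOrientedSetoid n)

/-- The tree-oriented map with a given half-edge description. -/
def TreeOrientedMap.mk {n : ℕ} (M : OrientedSystem n) (hM : M.IsTreeOriented) :
    TreeOrientedMap n :=
  Quotient.mk (treeOrientedSetoid n) ⟨M, hM⟩

open Finset

/-! ### Discrete Hodge theory on a map: genus bound and potentials of circulations. -/

namespace RotationSystem

variable {n : ℕ}

/-! Topology is replaced by linear algebra over ℚ on half-edges. Gradients of functions on vertices
are orthogonal to cogradients of functions on faces, so on a connected map the pair (vertex
function, face function), normalised at the root, is determined by the sum of the two. This gives V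
+ F ≤ n + 2 (`card_vertex_add_card_face_le`). Planarity is equality of dimensions, and then every
circulation is the cogradient of a potential on faces (`IsMap.exists_cograd`). This plays the role
of the Jordan curve theorem: a cycle separates the faces on which its potential differs.

Gluing. The tour of a tree enters each vertex through its unique head, so first corners are the
corners that follow heads. If F sums to zero over each part, its partial sums along the tour are
constant on the faces of the glued map; this is where non-crossing is used
(`IsNonCrossing.sum_lt_eq_sum_le`). These functions and the constants give n + 2 minus the number of
parts independent face functions, hence enough faces for planarity. The potential of a directed
cycle is largest at the root-face, because one reaches the root from any half-edge by turning around
vertices and going to parents without ever decreasing it (`le_root_of_glue`). It is strictly larger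
at the left of the cycle than at its right, so the root is not at the right.

Explosion. The exploded vertices correspond to heads, and each non-root head has a parent. If the
ancestors of some head miss the root, they contain a cycle. Its potential shows that the root is not
at the left of this cycle, since directed paths from the root could not leave that side; then a
simple subcycle is positive (`IsParentCycle.false_of_isTreeOriented`). So the exploded map is a
connected arborescence, and counting makes it a tree.

Inverse maps. Exploding a glued map gives back the tree and the partition directly. Conversely, on a
tree-oriented map the partial sums along the tour of the exploded tree are again face functions
(`tourSum_explode`). Applied to the difference of two indicators, this forces consecutive heads
around a vertex to be cyclically consecutive in their part, and forces the partition to be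
non-crossing. Hence gluing rebuilds the rotation of the map. -/

theorem vertex_eq_iff (M : RotationSystem n) (x y : Fin (2 * n + 1)) :
    M.vertex x = M.vertex y ↔ M.σ.SameCycle x y :=
  Quotient.eq (r := Equiv.Perm.SameCycle.setoid M.σ)

theorem vertex_surjective (M : RotationSystem n) : Function.Surjective M.vertex :=
  Quotient.exists_rep

theorem vertex_σ (M : RotationSystem n) (x : Fin (2 * n + 1)) :
    M.vertex (M.σ x) = M.vertex x :=
  (M.vertex_eq_iff _ _).2 (Equiv.Perm.sameCycle_apply_left.2 (.refl _ _))

theorem α_root (M : RotationSystem n) : M.α M.root = M.root := (M.α_eq_self_iff _).2 rfl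

instance (M : RotationSystem n) : Finite M.Vertex := Quotient.finite _

instance (M : RotationSystem n) : Finite M.Face := Quotient.finite _

/-- The face at the right of a half-edge. -/
def face (M : RotationSystem n) (h : Fin (2 * n + 1)) : M.Face :=
  Quotient.mk (Equiv.Perm.SameCycle.setoid M.facePerm) h

theorem face_surjective (M : RotationSystem n) : Function.Surjective M.face :=
  Quotient.exists_rep

theorem face_σ (M : RotationSystem n) (x : Fin (2 * n + 1)) :
    M.face (M.σ x) = M.face (M.α x) :=
  Quotient.sound (s := Equiv.Perm.SameCycle.setoid M.facePerm)
    (show M.facePerm.SameCycle _ _ by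
      have h : M.facePerm (M.α x) = M.σ x := by simp [facePerm, M.α_α]
      rw [← h]
      exact Equiv.Perm.sameCycle_apply_left.2 (.refl _ _))

/-- A function invariant under a permutation is constant on its cycles. -/
theorem apply_eq_of_sameCycle {X Y : Type*} [Finite X] {π : Equiv.Perm X} {f : X → Y}
    (hf : ∀ x, f (π x) = f x) {x y : X} (h : π.SameCycle x y) : f x = f y := by
  obtain ⟨k, rfl⟩ := h.exists_nat_pow_eq
  clear h
  induction k with
  | zero => rfl
  | succ k ih => rw [pow_succ', Equiv.Perm.mul_apply, hf, ih]

/-- Turns transitivity of the group into an induction principle from the root. Inverses are not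
needed in the inductive form because `σ` has finite order and `α` is an involution. -/
theorem connected_iff (M : RotationSystem n) :
    (∀ x y, ∃ g ∈ Subgroup.closure {M.σ, M.α}, g x = y) ↔
      ∀ Q : Fin (2 * n + 1) → Prop, Q M.root → (∀ x, Q x → Q (M.σ x)) →
        (∀ x, Q x → Q (M.α x)) → ∀ x, Q x := by
  constructor
  · intro h Q h0 hσ hα x
    have hσ' : ∀ x, Q (M.σ x) ↔ Q x := fun x => by
      refine ⟨fun hx => ?_, hσ x⟩
      have hp : ∀ k : ℕ, Q ((M.σ ^ k) (M.σ x)) := fun k => by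
        induction k with
        | zero => exact hx
        | succ k ih => rw [pow_succ', Equiv.Perm.mul_apply]; exact hσ _ ih
      have := hp (orderOf M.σ - 1)
      rwa [← Equiv.Perm.mul_apply, ← pow_succ, Nat.sub_add_cancel (orderOf_pos _),
        pow_orderOf_eq_one] at this
    have hα' : ∀ x, Q (M.α x) ↔ Q x := fun x =>
      ⟨fun hx => by simpa [M.α_α] using hα _ hx, hα x⟩
    obtain ⟨g, hg, rfl⟩ := h M.root x
    have key : ∀ y, Q (g y) ↔ Q y := by
      induction hg using Subgroup.closure_induction with
      | mem g hg =>
        rcases hg with rfl | rfl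
        · exact hσ'
        · exact hα'
      | one => intro y; rfl
      | mul g k _ _ hg hk => intro y; rw [Equiv.Perm.mul_apply, hg, hk]
      | inv g _ hg => intro y; rw [← hg]; simp
    exact (key _).2 h0
  · intro h
    have key : ∀ x, ∃ g ∈ Subgroup.closure {M.σ, M.α}, g M.root = x := by
      refine h _ ⟨1, one_mem _, rfl⟩ ?_ ?_
      · rintro _ ⟨g, hg, rfl⟩
        exact ⟨M.σ * g, mul_mem (Subgroup.subset_closure (by simp)) hg, rfl⟩
      · rintro _ ⟨g, hg, rfl⟩
        exact ⟨M.α * g, mul_mem (Subgroup.subset_closure (by simp)) hg, rfl⟩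
    intro x y
    obtain ⟨g, hg, rfl⟩ := key x
    obtain ⟨k, hk, rfl⟩ := key y
    exact ⟨k * g⁻¹, mul_mem hk (inv_mem hg), by simp⟩

theorem sum_α (M : RotationSystem n) (f : Fin (2 * n + 1) → ℚ) :
    ∑ x, f (M.α x) = ∑ x, f x :=
  Equiv.sum_comp M.α f

/-- Gradients and cogradients are orthogonal. -/
theorem sum_grad_mul_cograd (M : RotationSystem n) {u w : Fin (2 * n + 1) → ℚ}
    (hu : ∀ x, u (M.σ x) = u x) (hw : ∀ x, w (M.σ x) = w (M.α x)) :
    ∑ x, (u (M.α x) - u x) * (w (M.α x) - w x) = 0 := by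
  have h1 : ∑ x, u (M.α x) * w (M.α x) = ∑ x, u x * w x := M.sum_α fun x => u x * w x
  have h2 : ∑ x, u (M.α x) * w x = ∑ x, u x * w (M.α x) := by
    rw [← M.sum_α]
    simp only [M.α_α]
  have h3 : ∑ x, u x * w (M.α x) = ∑ x, u x * w x := by
    rw [← Equiv.sum_comp M.σ fun x => u x * w x]
    exact sum_congr rfl fun x _ => by rw [hu, hw]
  calc ∑ x, (u (M.α x) - u x) * (w (M.α x) - w x)
      = ∑ x, (u (M.α x) * w (M.α x) - u (M.α x) * w x - u x * w (M.α x) + u x * w x) :=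
        sum_congr rfl fun x _ => by ring
    _ = 0 := by
        rw [sum_add_distrib, sum_sub_distrib, sum_sub_distrib, h1, h2, h3]; ring

/-- The condition `x < M.α x` selects one half of each edge and discards the root. -/
theorem card_lt_α (M : RotationSystem n) : Fintype.card {x // x < M.α x} = n := by
  have h1 : Fintype.card {x // x < M.α x} = Fintype.card {x // M.α x < x} :=
    Fintype.card_congr (M.α.subtypeEquiv fun x => by rw [M.α_α])
  have h2 := Fintype.card_subtype_compl fun x => x = M.root
  have h3 : Fintype.card {x // ¬ x = M.root} =
      Fintype.card {x // x < M.α x} + Fintype.card {x // M.α x < x} := by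
    rw [← Fintype.card_subtype_or_disjoint]
    · refine Fintype.card_congr (Equiv.subtypeEquivRight fun x => ?_)
      rw [← M.α_eq_self_iff, ← ne_eq, ne_comm, lt_or_lt_iff_ne]
    · intro p hp hq x hx
      exact lt_asymm (hp x hx) (hq x hx)
  rw [Fintype.card_fin, Fintype.card_subtype_eq] at h2
  omega

theorem antisymm_ext (M : RotationSystem n) {f g : Fin (2 * n + 1) → ℚ}
    (hf : ∀ x, f (M.α x) = - f x) (hg : ∀ x, g (M.α x) = - g x)
    (h : ∀ x, x < M.α x → f x = g x) (x : Fin (2 * n + 1)) : f x = g x := by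
  rcases lt_trichotomy x (M.α x) with hx | hx | hx
  · exact h x hx
  · have h1 := hf x
    have h2 := hg x
    rw [← hx] at h1 h2
    linarith
  · have := h (M.α x) (by rwa [M.α_α])
    rw [hf, hg] at this
    linarith

/-- A pair of functions on vertices and on faces gives the sum of the gradient and the cogradient,
and the values at the root. -/
noncomputable def gradMap (M : RotationSystem n) :
    ((M.Vertex → ℚ) × (M.Face → ℚ)) →ₗ[ℚ] ({x // x < M.α x} → ℚ) × ℚ × ℚ where
  toFun p := (fun x => (p.1 (M.vertex (M.α x)) - p.1 (M.vertex x)) +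
    (p.2 (M.face (M.α x)) - p.2 (M.face x)), p.1 (M.vertex M.root), p.2 (M.face M.root))
  map_add' p q := by
    refine Prod.ext (funext fun x => ?_) rfl
    simp only [Prod.fst_add, Prod.snd_add, Pi.add_apply]
    ring
  map_smul' c p := by
    refine Prod.ext (funext fun x => ?_) rfl
    simp only [Prod.smul_fst, Prod.smul_snd, Pi.smul_apply, smul_eq_mul, RingHom.id_apply]
    ring

theorem eq_root_of_invariant (M : RotationSystem n)
    (hM : ∀ x y, ∃ g ∈ Subgroup.closure {M.σ, M.α}, g x = y) {Y : Type*}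
    {u : Fin (2 * n + 1) → Y}
    (hσ : ∀ x, u (M.σ x) = u x) (hα : ∀ x, u (M.α x) = u x) (x : Fin (2 * n + 1)) :
    u x = u M.root :=
  M.connected_iff.1 hM (fun x => u x = u M.root) rfl (fun x hx => by rw [hσ, hx])
    (fun x hx => by rw [hα, hx]) x

/-- By orthogonality the cogradient drops out of the hypothesis, which becomes the vanishing of a
sum of squares. -/
theorem grad_eq_zero (M : RotationSystem n) {u w : Fin (2 * n + 1) → ℚ}
    (h : ∑ x, (u (M.α x) - u x) * ((u (M.α x) - u x) + (w (M.α x) - w x)) = 0)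
    (hu : ∀ x, u (M.σ x) = u x) (hw : ∀ x, w (M.σ x) = w (M.α x)) (x : Fin (2 * n + 1)) :
    u (M.α x) - u x = 0 := by
  have h2 := M.sum_grad_mul_cograd hu hw
  simp only [mul_add, sum_add_distrib, h2, add_zero] at h
  have := (sum_eq_zero_iff_of_nonneg fun x _ => mul_self_nonneg _).1 h x (mem_univ _)
  exact mul_self_eq_zero.1 this

/-- If gradient and cogradient cancel, each vanishes by orthogonality; by connectedness both
functions are then constant, equal to their value 0 at the root. -/
theorem gradMap_injective (M : RotationSystem n)
    (hM : ∀ x y, ∃ g ∈ Subgroup.closure {M.σ, M.α}, g x = y) :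
    Function.Injective M.gradMap := by
  refine (injective_iff_map_eq_zero _).2 fun p hp => ?_
  obtain ⟨u, w⟩ := p
  have hd : ∀ x, (u (M.vertex (M.α x)) - u (M.vertex x)) +
      (w (M.face (M.α x)) - w (M.face x)) = 0 :=
    M.antisymm_ext (g := fun _ => 0) (fun x => by rw [M.α_α]; ring) (by simp)
      (fun x hx => congrFun (congrArg Prod.fst hp) ⟨x, hx⟩)
  have hur : u (M.vertex M.root) = 0 := congrArg (fun p => p.2.1) hp
  have hwr : w (M.face M.root) = 0 := congrArg (fun p => p.2.2) hp
  have hu0 := M.grad_eq_zero (u := fun x => u (M.vertex x)) (w := fun x => w (M.face x))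
    (by simp only [hd, mul_zero, sum_const_zero]) (fun x => by simp only [M.vertex_σ])
    (fun x => by simp only [M.face_σ])
  have hu : ∀ x, u (M.vertex x) = 0 := fun x =>
    (M.eq_root_of_invariant hM (u := fun x => u (M.vertex x))
      (fun x => by simp only [M.vertex_σ]) (fun x => sub_eq_zero.1 (hu0 x)) x).trans hur
  have hw0 : ∀ x, w (M.face (M.α x)) = w (M.face x) := fun x => by
    have := hd x
    rw [hu0, zero_add] at this
    exact sub_eq_zero.1 this
  have hw : ∀ x, w (M.face x) = 0 := fun x =>
    (M.eq_root_of_invariant hM (u := fun x => w (M.face x))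
      (fun x => by simp only [M.face_σ, hw0]) hw0 x).trans hwr
  refine Prod.ext (funext fun v => ?_) (funext fun v => ?_)
  · obtain ⟨x, rfl⟩ := M.vertex_surjective v
    exact hu x
  · obtain ⟨x, rfl⟩ := M.face_surjective v
    exact hw x

theorem finrank_gradMap (M : RotationSystem n) :
    Module.finrank ℚ ((M.Vertex → ℚ) × (M.Face → ℚ)) =
      Nat.card M.Vertex + Nat.card M.Face ∧
    Module.finrank ℚ (({x // x < M.α x} → ℚ) × ℚ × ℚ) = n + 2 := by
  have := Fintype.ofFinite M.Vertex
  have := Fintype.ofFinite M.Face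
  refine ⟨?_, ?_⟩
  · simp [Module.finrank_prod, Nat.card_eq_fintype_card]
  · rw [Module.finrank_prod, Module.finrank_prod, Module.finrank_fintype_fun_eq_card,
      M.card_lt_α, Module.finrank_self]

/-- The genus of a connected map is not negative. -/
theorem card_vertex_add_card_face_le (M : RotationSystem n)
    (hM : ∀ x y, ∃ g ∈ Subgroup.closure {M.σ, M.α}, g x = y) :
    Nat.card M.Vertex + Nat.card M.Face ≤ n + 2 := by
  have := LinearMap.finrank_le_finrank_of_injective (M.gradMap_injective hM)
  rwa [M.finrank_gradMap.1, M.finrank_gradMap.2] at this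

/-- On a planar map a circulation is a cogradient. -/
theorem IsMap.exists_cograd {M : RotationSystem n} (hM : M.IsMap) {f : Fin (2 * n + 1) → ℚ}
    (hf : ∀ x, f (M.α x) = - f x)
    (hc : ∀ u : Fin (2 * n + 1) → ℚ, (∀ x, u (M.σ x) = u x) → ∑ x, u x * f x = 0) :
    ∃ w : Fin (2 * n + 1) → ℚ, (∀ x, w (M.σ x) = w (M.α x)) ∧
      ∀ x, w (M.α x) - w x = f x := by
  -- Euler's relation says exactly that source and target of the injective `gradMap` have the same
  -- dimension.
  have hsurj : Function.Surjective M.gradMap :=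
    (LinearMap.injective_iff_surjective_of_finrank_eq_finrank
      (by rw [M.finrank_gradMap.1, M.finrank_gradMap.2, hM.euler])).1
      (M.gradMap_injective hM.connected)
  obtain ⟨⟨u, w⟩, hp⟩ := hsurj (fun x => f x, 0, 0)
  have hd : ∀ x, (u (M.vertex (M.α x)) - u (M.vertex x)) +
      (w (M.face (M.α x)) - w (M.face x)) = f x :=
    M.antisymm_ext (fun x => by rw [M.α_α]; ring) hf
      (fun x hx => congrFun (congrArg Prod.fst hp) ⟨x, hx⟩)
  have hu : ∑ x, u (M.vertex x) * f x = 0 := hc _ fun x => by rw [M.vertex_σ]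
  -- A circulation is orthogonal to all gradients, so the gradient part of its decomposition is
  -- zero.
  have hu0 := M.grad_eq_zero (u := fun x => u (M.vertex x)) (w := fun x => w (M.face x))
    (by
      simp only [hd, sub_mul, sum_sub_distrib, hu, sub_zero]
      rw [← M.sum_α]
      simp only [M.α_α, hf, mul_neg, sum_neg_distrib, hu, neg_zero])
    (fun x => by simp only [M.vertex_σ])
    (fun x => by simp only [M.face_σ])
  exact ⟨fun x => w (M.face x), fun x => by simp only [M.face_σ], fun x => by
    rw [← hd x, hu0, zero_add]⟩

end RotationSystem

/-! ### Orientation of a tree from the root to the leaves. -/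

namespace RotationSystem

variable {n : ℕ}

/-- The set `hd` of heads orients `T` from the root to the leaves: every vertex is incident to
exactly one head, and the root is reached from every head by passing repeatedly to the head of the
other end of the edge. -/
structure IsArborescence (T : RotationSystem n) (hd : Fin (2 * n + 1) → Prop) : Prop where
  root : hd T.root
  hd_α : ∀ h, h ≠ T.root → (hd (T.α h) ↔ ¬ hd h)
  exists_hd : ∀ x, ∃ h, hd h ∧ T.σ.SameCycle x h
  unique_hd : ∀ h h', hd h → hd h' → T.σ.SameCycle h h' → h = h'
  induct : ∀ Q : Fin (2 * n + 1) → Prop, Q T.root →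
    (∀ h g, hd h → hd g → T.σ.SameCycle (T.α h) g → Q g → Q h) → ∀ h, hd h → Q h

theorem ne_root_of_tail {T : RotationSystem n} {hd : Fin (2 * n + 1) → Prop} (hr : hd T.root)
    {x : Fin (2 * n + 1)} (hx : ¬ hd x) : x ≠ T.root := fun h => hx (h ▸ hr)

-- `α` exchanges the tails with the heads other than the root, and there are 2n + 1 half-edges in
-- all.
open Classical in
theorem card_hd (T : RotationSystem n) {hd : Fin (2 * n + 1) → Prop} (hr : hd T.root)
    (hα : ∀ h, h ≠ T.root → (hd (T.α h) ↔ ¬ hd h)) : Fintype.card {h // hd h} = n + 1 := by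
  rw [Fintype.card_subtype]
  change #(univ.filter hd) = n + 1
  have h1 := card_filter_add_card_filter_not (s := (univ : Finset (Fin (2 * n + 1)))) hd
  have h2 : (univ.filter fun h => ¬ hd h).image T.α = (univ.filter hd).erase T.root := by
    ext x
    simp only [mem_image, mem_filter, mem_univ, true_and, mem_erase]
    constructor
    · rintro ⟨y, hy, rfl⟩
      have hyr := ne_root_of_tail hr hy
      refine ⟨fun h => hyr ?_, (hα y hyr).2 hy⟩
      rw [← T.α_α y, h, T.α_root]
    · rintro ⟨hx, hxd⟩
      exact ⟨T.α x, fun h => (hα x hx).1 h hxd, T.α_α x⟩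
  have h3 := congrArg card h2
  rw [card_image_of_injective _ T.α.injective, card_erase_of_mem (by simpa using hr)] at h3
  have h4 : 0 < #(univ.filter hd) := card_pos.2 ⟨T.root, by simpa using hr⟩
  rw [card_univ, Fintype.card_fin] at h1
  omega

theorem IsArborescence.hd_of_hd {T : RotationSystem n} {A B : Fin (2 * n + 1) → Prop}
    (hA : T.IsArborescence A) (hB : T.IsArborescence B) : ∀ h, A h → B h := by
  refine hA.induct B hB.root fun h g hh hg hs hgB => ?_
  by_cases hr : h = T.root
  · exact hr ▸ hB.root
  by_contra hhB
  have := hB.unique_hd _ _ ((hB.hd_α h hr).2 hhB) hgB hs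
  exact (hA.hd_α h hr).1 (this ▸ hg) hh

/-- A tree has only one orientation from the root to the leaves. -/
theorem IsArborescence.unique {T : RotationSystem n} {A B : Fin (2 * n + 1) → Prop}
    (hA : T.IsArborescence A) (hB : T.IsArborescence B) : A = B :=
  funext fun h => propext ⟨hA.hd_of_hd hB h, hB.hd_of_hd hA h⟩

theorem reachable_root {T : RotationSystem n}
    (hT : ∀ x y, ∃ g ∈ Subgroup.closure {T.σ, T.α}, g x = y) (x : Fin (2 * n + 1)) :
    T.graph.Reachable (T.vertex T.root) (T.vertex x) := by
  refine T.connected_iff.1 hT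
    (fun x => T.graph.Reachable (T.vertex T.root) (T.vertex x)) (.refl _)
    (fun x hx => by rwa [T.vertex_σ]) (fun x hx => ?_) x
  by_cases h : T.vertex x = T.vertex (T.α x)
  · rwa [← h]
  · exact hx.trans (SimpleGraph.Adj.reachable
      ((SimpleGraph.fromRel_adj _ _ _).2 ⟨h, Or.inl ⟨x, rfl, rfl⟩⟩))

theorem exists_depth_lt {T : RotationSystem n}
    (hT : ∀ x y, ∃ g ∈ Subgroup.closure {T.σ, T.α}, g x = y) {v : T.Vertex}
    (hv : v ≠ T.vertex T.root) : ∃ x, T.vertex x = v ∧ T.depth (T.vertex (T.α x)) < T.depth v := by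
  have hreach : T.graph.Reachable (T.vertex T.root) v := by
    obtain ⟨y, rfl⟩ := T.vertex_surjective v
    exact reachable_root hT y
  obtain ⟨p, hp⟩ := hreach.exists_walk_length_eq_dist
  have hp' : p.reverse.length = T.depth v := by rw [p.length_reverse, hp]; rfl
  generalize p.reverse = q at hp'
  rw [depth] at *
  have hdef : ∀ u, T.depth u = T.graph.dist (T.vertex T.root) u := fun _ => rfl
  simp only [hdef]
  generalize T.vertex T.root = r at *
  cases q with
  | nil => exact absurd rfl hv
  | @cons _ u _ h q =>
    have hd : T.graph.dist r u < T.graph.dist r v := by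
      rw [← hp', SimpleGraph.Walk.length_cons, Nat.lt_succ_iff, ← q.length_reverse]
      exact SimpleGraph.dist_le q.reverse
    obtain ⟨-, ⟨x, h1, h2⟩ | ⟨x, h1, h2⟩⟩ := (SimpleGraph.fromRel_adj _ _ _).1 h
    · exact ⟨x, h1, by rwa [h2]⟩
    · exact ⟨T.α x, h2, by rwa [T.α_α, h1]⟩

theorem IsTree.card_vertex {T : RotationSystem n} (hT : T.IsTree) : Nat.card T.Vertex = n + 1 := by
  have h1 := hT.isMap.euler
  have h2 := hT.card_face
  omega

open Classical in
/-- The orientation of a tree by the distance to the root. -/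
theorem IsTree.isArborescence_depth {T : RotationSystem n} (hT : T.IsTree) :
    T.IsArborescence fun h => h = T.root ∨ T.depth (T.vertex (T.α h)) < T.depth (T.vertex h) := by
  set hd : Fin (2 * n + 1) → Prop := fun h =>
    h = T.root ∨ T.depth (T.vertex (T.α h)) < T.depth (T.vertex h) with hhd
  have := Fintype.ofFinite T.Vertex
  have hroot : hd T.root := Or.inl rfl
  -- Heads surject onto the n + 1 vertices, while no edge carries two of them, so there are at most
  -- n + 1. Equality gives one head per vertex, and rules out edges between vertices of equal depth.
  have hsurj : Function.Surjective fun h : {h // hd h} => T.vertex h.1 := by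
    intro v
    by_cases hv : v = T.vertex T.root
    · exact ⟨⟨T.root, hroot⟩, hv.symm⟩
    · obtain ⟨x, rfl, hx⟩ := exists_depth_lt hT.isMap.connected hv
      exact ⟨⟨x, Or.inr hx⟩, rfl⟩
  have hne : ∀ h, h ≠ T.root → hd h → ¬ hd (T.α h) := by
    intro h hr hh hh'
    have h1 := hh.resolve_left hr
    have h2 := hh'.resolve_left fun h' => hr (by rw [← T.α_α h, h', T.α_root])
    rw [T.α_α] at h2
    exact lt_asymm h1 h2
  have hsub : ((univ.filter hd).erase T.root).image T.α ⊆ univ.filter fun h => ¬ hd h := by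
    intro x
    simp only [mem_image, mem_filter, mem_univ, true_and, mem_erase]
    rintro ⟨y, ⟨hy, hyd⟩, rfl⟩
    exact hne y hy hyd
  have h1 := card_filter_add_card_filter_not (s := (univ : Finset (Fin (2 * n + 1)))) hd
  have h2 := card_le_card hsub
  rw [card_image_of_injective _ T.α.injective, card_erase_of_mem (by simpa using hroot)] at h2
  rw [card_univ, Fintype.card_fin] at h1
  have h3 := Fintype.card_le_of_surjective _ hsurj
  have h4 := hT.card_vertex
  rw [Nat.card_eq_fintype_card] at h4
  rw [Fintype.card_subtype, h4] at h3
  change n + 1 ≤ #(univ.filter hd) at h3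
  have hcard : #(univ.filter hd) = n + 1 := by omega
  have heq : ((univ.filter hd).erase T.root).image T.α = univ.filter fun h => ¬ hd h := by
    refine eq_of_subset_of_card_le hsub ?_
    rw [card_image_of_injective _ T.α.injective, card_erase_of_mem (by simpa using hroot)]
    omega
  have hinj : Function.Injective fun h : {h // hd h} => T.vertex h.1 :=
    ((Fintype.bijective_iff_surjective_and_card _).2
      ⟨hsurj, by rw [Fintype.card_subtype, hcard, h4]⟩).1
  have hex : ∀ x, ∃ h, hd h ∧ T.σ.SameCycle x h := by
    intro x
    obtain ⟨h, hh⟩ := hsurj (T.vertex x)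
    exact ⟨h.1, h.2, (T.vertex_eq_iff _ _).1 hh.symm⟩
  refine ⟨hroot, fun h hr => ⟨fun h1 h2 => hne h hr h2 h1, fun hh => ?_⟩, hex,
    fun h h' hh hh' hs => ?_, fun Q hQ hstep h hh => ?_⟩
  · have : h ∈ ((univ.filter hd).erase T.root).image T.α := by rw [heq]; simpa using hh
    simp only [mem_image, mem_filter, mem_univ, true_and, mem_erase] at this
    obtain ⟨y, ⟨-, hy⟩, rfl⟩ := this
    rwa [T.α_α]
  · exact congrArg Subtype.val (@hinj ⟨h, hh⟩ ⟨h', hh'⟩ ((T.vertex_eq_iff _ _).2 hs))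
  · induction hk : T.depth (T.vertex h) using Nat.strong_induction_on generalizing h with
    | _ k ih =>
      by_cases hr : h = T.root
      · exact hr ▸ hQ
      obtain ⟨g, hg, hs⟩ := hex (T.α h)
      have hlt := hh.resolve_left hr
      rw [(T.vertex_eq_iff _ _).2 hs, hk] at hlt
      exact hstep h g hh hg hs (ih _ hlt g hg rfl)

/-! ### The tour of a tree and partial sums along it. -/

theorem corner_zero (T : RotationSystem n) : T.corner 0 = T.root := by
  simp [corner, T.α_root]

theorem corner_succ (T : RotationSystem n) (j : ℕ) :
    T.corner (j + 1) = T.α (T.σ (T.corner j)) := by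
  rw [corner, corner, pow_succ', Equiv.Perm.mul_apply]
  rfl

/-- The tour enters each vertex by its head. -/
theorem IsArborescence.hd_corner {T : RotationSystem n} {hd : Fin (2 * n + 1) → Prop}
    (hA : T.IsArborescence hd) {j : ℕ} (hj : T.IsFirstVisit j) : hd (T.corner j) := by
  classical
  induction j using Nat.strong_induction_on with
  | _ j ih =>
    rcases j with _ | j
    · rw [corner_zero]; exact hA.root
    by_contra hx
    have hxr := ne_root_of_tail hA.root hx
    have hy := (hA.hd_α _ hxr).2 hx
    have hyv : T.α (T.corner (j + 1)) = T.σ (T.corner j) := by rw [corner_succ, T.α_α]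
    have hex : ∃ i, T.vertex (T.corner i) = T.vertex (T.corner j) := ⟨j, rfl⟩
    have hi := Nat.find_spec hex
    have hle : Nat.find hex ≤ j := Nat.find_min' hex rfl
    have hfirst : T.IsFirstVisit (Nat.find hex) := fun i h => by
      rw [hi]; exact Nat.find_min hex h
    have hhd := ih _ (Nat.lt_succ_of_le hle) hfirst
    -- The tour would leave the vertex of `corner j` through its head. By induction this is the
    -- half-edge by which it first arrived there, so the vertex at the other end was already met.
    have heq : T.corner (Nat.find hex) = T.α (T.corner (j + 1)) :=
      hA.unique_hd _ _ hhd hy ((T.vertex_eq_iff _ _).1 (by rw [hi, hyv, T.vertex_σ]))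
    generalize Nat.find hex = i at *
    rcases i with _ | i
    · rw [corner_zero] at heq
      exact hxr (by rw [← T.α_α (T.corner (j + 1)), ← heq, T.α_root])
    · rw [corner_succ] at heq
      have := T.α.injective heq
      exact hj i (by omega) (by rw [← this, T.vertex_σ])

/-- The time at which the tour meets the first corner of the `i`-th vertex. -/
noncomputable def firstTime (T : RotationSystem n) (i : Fin (n + 1)) : ℕ :=
  Nat.nth T.IsFirstVisit i

/-- The time at which the tour meets the corner at the other end of the half-edge `x`. -/
noncomputable def tourTime (T : RotationSystem n) (x : Fin (2 * n + 1)) : ℕ :=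
  sInf {t | (T.facePerm ^ t) T.root = x}

theorem firstCorner_eq (T : RotationSystem n) (i : Fin (n + 1)) :
    T.firstCorner i = T.corner (T.firstTime i) := rfl

namespace IsTree

variable {T : RotationSystem n} (hT : T.IsTree)
include hT

theorem lt_card_isFirstVisit (i : Fin (n + 1)) (hf : {j | T.IsFirstVisit j}.Finite) :
    (i : ℕ) < #hf.toFinset := by
  by_contra h
  push Not at h
  have h0 : T.IsFirstVisit 0 := fun i hi => absurd hi (Nat.not_lt_zero i)
  have hpos : 0 < #hf.toFinset := card_pos.2 ⟨0, by simpa using h0⟩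
  -- Default value: past the last index `Nat.nth` returns 0, so vertex `i` would share its first
  -- corner with vertex 0.
  have h1 : Nat.nth T.IsFirstVisit i = 0 := Nat.nth_of_card_le hf h
  have h2 : Nat.nth T.IsFirstVisit 0 = 0 := Nat.nth_zero_of_zero h0
  have := hT.firstCorner_injective (a₁ := i) (a₂ := 0) (by
    rw [firstCorner, firstCorner, h1, Fin.val_zero, h2])
  rw [this, Fin.val_zero] at h
  omega

theorem isFirstVisit_firstTime (i : Fin (n + 1)) : T.IsFirstVisit (T.firstTime i) :=
  Nat.nth_mem _ (hT.lt_card_isFirstVisit i)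

theorem firstTime_strictMono : StrictMono T.firstTime := by
  have hF : {j | T.IsFirstVisit j}.Finite := by
    refine Set.Finite.of_finite_image (f := fun j => T.vertex (T.corner j)) (Set.toFinite _) ?_
    intro i hi j hj hij
    rcases lt_trichotomy i j with h | h | h
    · exact absurd hij (hj i h)
    · exact h
    · exact absurd hij.symm (hi j h)
  intro i j hij
  exact Nat.nth_strictMonoOn hF (hT.lt_card_isFirstVisit i hF) (hT.lt_card_isFirstVisit j hF) hij

theorem isCycleOn_facePerm :
    T.facePerm.IsCycleOn ((univ : Finset (Fin (2 * n + 1))) : Set (Fin (2 * n + 1))) := by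
  have hsub : Subsingleton T.Face := (Nat.card_eq_one_iff_unique.mp hT.card_face).1
  refine ⟨by simp, fun x _ y _ => ?_⟩
  exact Quotient.exact (s := Equiv.Perm.SameCycle.setoid T.facePerm) (Subsingleton.elim (α := T.Face)
    (Quotient.mk (Equiv.Perm.SameCycle.setoid T.facePerm) x)
    (Quotient.mk (Equiv.Perm.SameCycle.setoid T.facePerm) y))

theorem pow_facePerm_eq_iff (s t : ℕ) :
    (T.facePerm ^ s) T.root = (T.facePerm ^ t) T.root ↔ s ≡ t [MOD 2 * n + 1] := by
  rw [hT.isCycleOn_facePerm.pow_apply_eq_pow_apply (mem_univ _), card_univ, Fintype.card_fin]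

theorem pow_tourTime (x : Fin (2 * n + 1)) : (T.facePerm ^ T.tourTime x) T.root = x := by
  obtain ⟨t, -, ht⟩ := hT.isCycleOn_facePerm.exists_pow_eq (mem_univ T.root) (mem_univ x)
  exact Nat.sInf_mem (s := {t | (T.facePerm ^ t) T.root = x}) ⟨t, ht⟩

theorem tourTime_lt (x : Fin (2 * n + 1)) : T.tourTime x < 2 * n + 1 := by
  obtain ⟨t, hlt, ht⟩ := hT.isCycleOn_facePerm.exists_pow_eq (mem_univ T.root) (mem_univ x)
  rw [card_univ, Fintype.card_fin] at hlt
  exact (Nat.sInf_le (s := {t | (T.facePerm ^ t) T.root = x}) ht).trans_lt hlt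

theorem tourTime_pow {t : ℕ} (ht : t < 2 * n + 1) : T.tourTime ((T.facePerm ^ t) T.root) = t := by
  have := (hT.pow_facePerm_eq_iff _ _).1 (hT.pow_tourTime ((T.facePerm ^ t) T.root))
  exact Nat.ModEq.eq_of_lt_of_lt this (hT.tourTime_lt _) ht

theorem tourTime_facePerm (x : Fin (2 * n + 1)) :
    T.tourTime (T.facePerm x) = if T.tourTime x = 2 * n then 0 else T.tourTime x + 1 := by
  have h := hT.pow_tourTime x
  have h1 : T.facePerm x = (T.facePerm ^ (T.tourTime x + 1)) T.root := by
    rw [pow_succ', Equiv.Perm.mul_apply, h]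
  have hlt := hT.tourTime_lt x
  split_ifs with hx
  · have h2 : (T.facePerm ^ (T.tourTime x + 1)) T.root = (T.facePerm ^ 0) T.root :=
      (hT.pow_facePerm_eq_iff _ _).2 (by rw [hx]; simp [Nat.ModEq])
    rw [h1, h2, hT.tourTime_pow (by omega)]
  · rw [h1, hT.tourTime_pow (by omega)]

theorem firstTime_lt (i : Fin (n + 1)) : T.firstTime i < 2 * n + 1 := by
  by_contra h
  push Not at h
  refine hT.isFirstVisit_firstTime i (T.firstTime i % (2 * n + 1))
    ((Nat.mod_lt _ (by omega)).trans_le h) ?_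
  rw [corner, corner, (hT.pow_facePerm_eq_iff _ _).2 (Nat.mod_modEq _ _)]

theorem tourTime_α_firstCorner (i : Fin (n + 1)) :
    T.tourTime (T.α (T.firstCorner i)) = T.firstTime i := by
  rw [firstCorner_eq, corner, T.α_α, hT.tourTime_pow (hT.firstTime_lt i)]

theorem eq_firstCorner_of_tourTime {x : Fin (2 * n + 1)} {i : Fin (n + 1)}
    (h : T.tourTime (T.α x) = T.firstTime i) : x = T.firstCorner i := by
  rw [firstCorner_eq, corner, ← h, hT.pow_tourTime, T.α_α]

theorem hd_firstCorner {hd : Fin (2 * n + 1) → Prop} (hA : T.IsArborescence hd)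
    (i : Fin (n + 1)) : hd (T.firstCorner i) :=
  hA.hd_corner (hT.isFirstVisit_firstTime i)

/-- The first corners are those which follow the heads. -/
theorem exists_firstCorner_iff {hd : Fin (2 * n + 1) → Prop} (hA : T.IsArborescence hd)
    (x : Fin (2 * n + 1)) : (∃ i, T.firstCorner i = x) ↔ hd x := by
  classical
  refine ⟨by rintro ⟨i, rfl⟩; exact hT.hd_firstCorner hA i, fun hx => ?_⟩
  have hinj : Function.Injective fun i => (⟨T.firstCorner i, hT.hd_firstCorner hA i⟩ : {h // hd h}) :=
    fun i j hij => hT.firstCorner_injective (congrArg Subtype.val hij)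
  have := ((Fintype.bijective_iff_injective_and_card _).2 ⟨hinj, by
    rw [T.card_hd hA.root hA.hd_α, Fintype.card_fin]⟩).2 ⟨x, hx⟩
  obtain ⟨i, hi⟩ := this
  exact ⟨i, congrArg Subtype.val hi⟩

end IsTree

/-- The sum of a function over the vertices already seen by the tour. -/
noncomputable def tourSum (T : RotationSystem n) (F : Fin (n + 1) → ℚ) (x : Fin (2 * n + 1)) : ℚ :=
  ∑ b, if T.firstTime b < T.tourTime x then F b else 0

namespace IsTree

variable {T : RotationSystem n} (hT : T.IsTree)
include hT

theorem tourSum_α_firstCorner (F : Fin (n + 1) → ℚ) (a : Fin (n + 1)) :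
    T.tourSum F (T.α (T.firstCorner a)) = ∑ b, if b < a then F b else 0 := by
  simp only [tourSum, hT.tourTime_α_firstCorner, hT.firstTime_strictMono.lt_iff_lt]

theorem tourTime_σ (x : Fin (2 * n + 1)) :
    T.tourTime (T.σ x) = if T.tourTime (T.α x) = 2 * n then 0 else T.tourTime (T.α x) + 1 := by
  rw [← hT.tourTime_facePerm, facePerm, Equiv.Perm.mul_apply, T.α_α]

/-- Passing the corner after `x` advances the tour by one step and turns `<` into `≤`. At the last
corner the time falls back from 2n to 0, which is consistent only because the total of `F` is zero.
-/
theorem tourSum_σ {F : Fin (n + 1) → ℚ} (hF : ∑ b, F b = 0) (x : Fin (2 * n + 1)) :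
    T.tourSum F (T.σ x) = ∑ b, if T.firstTime b ≤ T.tourTime (T.α x) then F b else 0 := by
  rw [tourSum, hT.tourTime_σ]
  split_ifs with h
  · simp only [Nat.not_lt_zero, if_false, sum_const_zero, h]
    rw [← hF]
    exact sum_congr rfl fun b _ => (if_pos (Nat.lt_succ_iff.1 (hT.firstTime_lt b))).symm
  · simp only [Nat.lt_succ_iff]

theorem tourSum_σ_firstCorner {F : Fin (n + 1) → ℚ} (hF : ∑ b, F b = 0) (a : Fin (n + 1)) :
    T.tourSum F (T.σ (T.firstCorner a)) = ∑ b, if b ≤ a then F b else 0 := by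
  simp only [hT.tourSum_σ hF, hT.tourTime_α_firstCorner, hT.firstTime_strictMono.le_iff_le]

/-- The partial sum jumps at first corners only. -/
theorem tourSum_σ_of_notMem {F : Fin (n + 1) → ℚ} (hF : ∑ b, F b = 0) {x : Fin (2 * n + 1)}
    (hx : ∀ i, T.firstCorner i ≠ x) : T.tourSum F (T.σ x) = T.tourSum F (T.α x) := by
  rw [hT.tourSum_σ hF, tourSum]
  refine sum_congr rfl fun b _ => ?_
  have : T.firstTime b ≠ T.tourTime (T.α x) := fun h =>
    hx b (hT.eq_firstCorner_of_tourTime h.symm).symm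
  simp only [this.le_iff_lt]

end IsTree

end RotationSystem

/-! ### Induced permutations and cyclic predecessors in a part. -/

theorem inducedPerm_apply {H : Type*} [Finite H] (π : Equiv.Perm H) (r : Setoid H) (x : H) :
    inducedPerm π r x = inducedFun π r x := rfl

theorem rel_inducedPerm {H : Type*} [Finite H] (π : Equiv.Perm H) (r : Setoid H) (x : H) :
    r x (inducedPerm π r x) := by
  obtain ⟨k, -, h1, h2, -⟩ := inducedFun_spec π r x
  rwa [inducedPerm_apply, h2]

theorem inducedPerm_eq_of_rel {H : Type*} [Finite H] {π : Equiv.Perm H} {r : Setoid H} {x : H}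
    (h : r x (π x)) : inducedPerm π r x = π x := by
  obtain ⟨k, h0, h1, h2, h3⟩ := inducedFun_spec π r x
  have : k = 1 := le_antisymm (h3 1 one_pos (by simpa using h)) h0
  rw [inducedPerm_apply, h2, this, pow_one]

/-- Each class of `r` inside a cycle of `π` is a cycle of the induced permutation. -/
theorem sameCycle_inducedPerm {H : Type*} [Finite H] {π : Equiv.Perm H} {r : Setoid H} (m : ℕ) :
    ∀ x, r x ((π ^ m) x) → (inducedPerm π r).SameCycle x ((π ^ m) x) := by
  induction m using Nat.strong_induction_on with
  | _ m ih =>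
    intro x hx
    rcases Nat.eq_zero_or_pos m with rfl | hm
    · exact .refl _ _
    obtain ⟨k, h0, h1, h2, h3⟩ := inducedFun_spec π r x
    have hkm := h3 m hm hx
    have hpow : (π ^ m) x = (π ^ (m - k)) ((π ^ k) x) := by
      rw [← Equiv.Perm.mul_apply, ← pow_add, Nat.sub_add_cancel hkm]
    have := ih (m - k) (by omega) ((π ^ k) x) (by rw [← hpow]; exact r.trans' (r.symm' h1) hx)
    rw [hpow]
    rw [← h2, ← inducedPerm_apply] at this ⊢
    exact Equiv.Perm.sameCycle_apply_left.1 this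

/-- `b` cyclically precedes `a` in the part of `a`. -/
def CyclicPred {S : Type*} [LinearOrder S] (s : Setoid S) (a b : S) : Prop :=
  s a b ∧ ((b < a ∧ ∀ c, b < c → c < a → ¬ s a c) ∨
    (a ≤ b ∧ (∀ c, c < a → ¬ s a c) ∧ ∀ c, b < c → ¬ s a c))

theorem CyclicPred.unique {S : Type*} [LinearOrder S] {s : Setoid S} {a b b' : S}
    (h : CyclicPred s a b) (h' : CyclicPred s a b') : b = b' := by
  obtain ⟨h1, ⟨h2, h3⟩ | ⟨h2, h3, h4⟩⟩ := h <;>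
    obtain ⟨g1, ⟨g2, g3⟩ | ⟨g2, g3, g4⟩⟩ := h'
  · rcases lt_trichotomy b b' with h | h | h
    · exact absurd g1 (h3 _ h g2)
    · exact h
    · exact absurd h1 (g3 _ h h2)
  · exact absurd h1 (g3 _ h2)
  · exact absurd g1 (h3 _ g2)
  · rcases lt_trichotomy b b' with h | h | h
    · exact absurd g1 (h4 _ h)
    · exact h
    · exact absurd h1 (g4 _ h)

theorem val_finRotate_inv_pow {n : ℕ} (a : Fin (n + 1)) (k : ℕ) (hk : k ≤ n + 1) :
    ((((finRotate (n + 1))⁻¹ ^ k) a : Fin (n + 1)) : ℕ) =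
      if k ≤ a then (a : ℕ) - k else n + 1 + a - k := by
  induction k with
  | zero => simp
  | succ k ih =>
    have ih := ih (by omega)
    have ha := a.2
    rw [pow_succ', Equiv.Perm.mul_apply]
    generalize ((finRotate (n + 1))⁻¹ ^ k) a = b at *
    have hb : (finRotate (n + 1))⁻¹ b = b - 1 := by
      rw [Equiv.Perm.inv_eq_iff_eq, finRotate_apply, sub_add_cancel]
    rw [hb]
    by_cases h0 : b = 0
    · have hv : ((0 - 1 : Fin (n + 1)) : ℕ) = n := by rw [zero_sub, Fin.coe_neg_one]
      rw [h0, Fin.val_zero] at ih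
      rw [h0, hv]
      split_ifs at ih ⊢ <;> omega
    · have hp : 0 < (b : ℕ) := Nat.pos_of_ne_zero fun h => h0 (Fin.ext h)
      rw [Fin.val_sub_one_of_ne_zero h0]
      split_ifs at ih ⊢ <;> omega

/-- The induced permutation goes down step by step until it meets the part of `a` again. Without
wrapping this is the preceding element; with wrapping, `a` is the least element of its part and the
image the greatest. -/
theorem cyclicPred_inducedPerm {n : ℕ} (s : Setoid (Fin (n + 1))) (a : Fin (n + 1)) :
    CyclicPred s a (inducedPerm (finRotate (n + 1))⁻¹ s a) := by
  refine ⟨rel_inducedPerm _ s a, ?_⟩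
  obtain ⟨k, h0, h1, h2, h3⟩ := inducedFun_spec (finRotate (n + 1))⁻¹ s a
  have ha := a.2
  have hk : k ≤ n + 1 := by
    refine h3 (n + 1) (by omega) ?_
    have : ((finRotate (n + 1))⁻¹ ^ (n + 1)) a = a := by
      refine Fin.ext ?_
      rw [val_finRotate_inv_pow a _ le_rfl, if_neg (by omega)]
      omega
    rw [this]
  have hmin : ∀ (c : Fin (n + 1)) (m : ℕ), 0 < m → m < k →
      (if m ≤ a then (a : ℕ) - m else n + 1 + a - m) = c → ¬ s a c := by
    intro c m hm hmk hc hs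
    have : ((finRotate (n + 1))⁻¹ ^ m) a = c :=
      Fin.ext ((val_finRotate_inv_pow a m (by omega)).trans hc)
    exact absurd (h3 m hm (this ▸ hs)) (by omega)
  have hv := val_finRotate_inv_pow a k hk
  rw [inducedPerm_apply, h2]
  generalize ((finRotate (n + 1))⁻¹ ^ k) a = b at *
  have hbn := b.2
  by_cases hka : k ≤ a
  · rw [if_pos hka] at hv
    refine Or.inl ⟨Fin.lt_def.2 (by omega), fun c hc hca => ?_⟩
    rw [Fin.lt_def] at hc hca
    exact hmin c (a - c) (by omega) (by omega) (by rw [if_pos (by omega)]; omega)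
  · rw [if_neg hka] at hv
    refine Or.inr ⟨Fin.le_def.2 (by omega), fun c hc => ?_, fun c hc => ?_⟩
    · rw [Fin.lt_def] at hc
      exact hmin c (a - c) (by omega) (by omega) (by rw [if_pos (by omega)]; omega)
    · rw [Fin.lt_def] at hc
      have hcn := c.2
      exact hmin c (n + 1 + a - c) (by omega) (by omega) (by rw [if_neg (by omega)]; omega)

theorem sameCycle_inducedPerm_finRotate {n : ℕ} {s : Setoid (Fin (n + 1))} {a b : Fin (n + 1)}
    (h : s a b) : (inducedPerm (finRotate (n + 1))⁻¹ s).SameCycle a b := by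
  have : ∃ m : ℕ, ((finRotate (n + 1))⁻¹ ^ m) a = b := by
    have ha := a.2
    have hb := b.2
    by_cases hab : b ≤ a
    · rw [Fin.le_def] at hab
      refine ⟨a - b, Fin.ext ?_⟩
      rw [val_finRotate_inv_pow _ _ (by omega), if_pos (by omega)]
      omega
    · rw [Fin.le_def] at hab
      refine ⟨n + 1 + a - b, Fin.ext ?_⟩
      rw [val_finRotate_inv_pow _ _ (by omega), if_neg (by omega)]
      omega
  obtain ⟨m, rfl⟩ := this
  exact sameCycle_inducedPerm m a h

/-! ### Non-crossing partitions and functions of zero sum on each part. -/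

/-- A function whose sum over each part vanishes. -/
def IsBlockFree {S : Type*} [Fintype S] (s : Setoid S) (F : S → ℚ) : Prop :=
  ∀ u : S → ℚ, (∀ a b, s a b → u a = u b) → ∑ b, u b * F b = 0

theorem IsBlockFree.sum_eq_zero {S : Type*} [Fintype S] {s : Setoid S} {F : S → ℚ}
    (h : IsBlockFree s F) : ∑ b, F b = 0 := by
  simpa using h (fun _ => 1) fun _ _ _ => rfl

open Classical in
/-- On the parts of a non-crossing partition, the partial sums of a function that sums to zero over
each part agree at cyclically consecutive elements. -/
theorem IsNonCrossing.sum_lt_eq_sum_le {S : Type*} [Fintype S] [LinearOrder S] {s : Setoid S}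
    (hs : IsNonCrossing s) {F : S → ℚ} (hF : IsBlockFree s F) {a b : S} (hab : CyclicPred s a b) :
    (∑ c, if c < a then F c else 0) = ∑ c, if c ≤ b then F c else 0 := by
  obtain ⟨h1, ⟨h2, h3⟩ | ⟨h2, h3, h4⟩⟩ := hab
  -- The interval strictly between `b` and `a` contains no element of their part, and a part with
  -- points inside and outside would cross it. So the interval is a union of parts, and its
  -- indicator can be tested against `F`.
  · have hout : ∀ c d, s c d → b < c → c < a → b < d ∧ d < a := by
      intro c d hcd hbc hca
      have hac := h3 c hbc hca
      have hda : d ≠ a := fun h => hac (s.symm' (h ▸ hcd))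
      have hdb : d ≠ b := fun h => hac (s.trans' h1 (s.symm' (h ▸ hcd)))
      refine ⟨lt_of_not_ge fun h => ?_, lt_of_not_ge fun h => ?_⟩
      · exact hs ⟨d, b, c, a, lt_of_le_of_ne h hdb, hbc, hca, s.symm' hcd, s.symm' h1,
          fun h' => hac (s.symm' (s.trans' (s.trans' hcd h') (s.symm' h1)))⟩
      · exact hs ⟨b, c, a, d, hbc, hca, lt_of_le_of_ne h hda.symm, s.symm' h1, hcd,
          fun h' => hac (s.trans' h1 h')⟩
    have := hF (fun c => if b < c ∧ c < a then 1 else 0) fun c d hcd => by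
      have : (b < c ∧ c < a) ↔ (b < d ∧ d < a) :=
        ⟨fun h => hout c d hcd h.1 h.2, fun h => hout d c (s.symm' hcd) h.1 h.2⟩
      simp only [this]
    rw [← sub_eq_zero, ← sum_sub_distrib]
    refine Eq.trans ?_ this
    refine sum_congr rfl fun c _ => ?_
    by_cases hca : c < a <;> by_cases hcb : c ≤ b
    · simp [hca, hcb, not_lt.2 hcb]
    · simp [hca, hcb, not_le.1 hcb]
    · exact absurd (hcb.trans_lt h2) hca
    · simp [hca, hcb]
  -- In the wrapped case the closed interval from the least to the greatest element of the part is a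
  -- union of parts.
  · have hout : ∀ c d, s c d → a ≤ c → c ≤ b → a ≤ d ∧ d ≤ b := by
      intro c d hcd hac hcb
      by_cases hsa : s a c
      · exact ⟨le_of_not_gt fun h => h3 d h (s.trans' hsa hcd),
          le_of_not_gt fun h => h4 d h (s.trans' hsa hcd)⟩
      have hca : a < c := lt_of_le_of_ne hac fun h => hsa (h ▸ s.refl' a)
      have hcb' : c < b := lt_of_le_of_ne hcb fun h => hsa (h ▸ h1)
      refine ⟨le_of_not_gt fun h => ?_, le_of_not_gt fun h => ?_⟩
      · exact hs ⟨d, a, c, b, h, hca, hcb', s.symm' hcd, h1,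
          fun h' => hsa (s.symm' (s.trans' hcd h'))⟩
      · exact hs ⟨a, c, b, d, hca, hcb', h, h1, hcd, hsa⟩
    have := hF (fun c => if a ≤ c ∧ c ≤ b then 1 else 0) fun c d hcd => by
      have : (a ≤ c ∧ c ≤ b) ↔ (a ≤ d ∧ d ≤ b) :=
        ⟨fun h => hout c d hcd h.1 h.2, fun h => hout d c (s.symm' hcd) h.1 h.2⟩
      simp only [this]
    rw [eq_comm, ← sub_eq_zero, ← sum_sub_distrib]
    refine Eq.trans ?_ this
    refine sum_congr rfl fun c _ => ?_
    by_cases hca : c < a <;> by_cases hcb : c ≤ b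
    · simp [hca, hcb, not_le.2 hca]
    · exact absurd (hca.le.trans h2) hcb
    · simp [hca, hcb, not_lt.1 hca]
    · simp [hca, hcb]

/-- The functions that sum to zero over each part. -/
theorem exists_blockFree {S : Type*} [Fintype S] (s : Setoid S) :
    ∃ K : Submodule ℚ (S → ℚ), (∀ F ∈ K, IsBlockFree s F) ∧
      Fintype.card S ≤ Module.finrank ℚ K + Nat.card (Quotient s) := by
  classical
  let B : (S → ℚ) →ₗ[ℚ] (Quotient s → ℚ) :=
    { toFun := fun F q => ∑ b, if Quotient.mk s b = q then F b else 0
      map_add' := fun F G => funext fun q => by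
        simp only [Pi.add_apply]
        rw [← sum_add_distrib]
        exact sum_congr rfl fun b _ => by split_ifs <;> simp
      map_smul' := fun c F => funext fun q => by
        simp only [Pi.smul_apply, smul_eq_mul, RingHom.id_apply]
        rw [mul_sum]
        exact sum_congr rfl fun b _ => by split_ifs <;> simp }
  refine ⟨LinearMap.ker B, fun F hF u hu => ?_, ?_⟩
  · have hB : ∀ q, (∑ b, if Quotient.mk s b = q then F b else 0) = 0 :=
      fun q => congrFun (LinearMap.mem_ker.1 hF) q
    have h1 : ∀ b, u b * F b =
        ∑ q : Quotient s, u q.out * if Quotient.mk s b = q then F b else 0 := by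
      intro b
      simp only [mul_ite, mul_zero, sum_ite_eq, mem_univ, if_true]
      rw [hu _ _ (Quotient.exact (Quotient.out_eq (Quotient.mk s b)))]
    simp only [h1]
    rw [sum_comm]
    refine sum_eq_zero fun q _ => ?_
    rw [← mul_sum, hB, mul_zero]
  · have h1 := LinearMap.finrank_range_add_finrank_ker B
    have h2 := Submodule.finrank_le (LinearMap.range B)
    rw [Module.finrank_fintype_fun_eq_card] at h1 h2
    rw [Nat.card_eq_fintype_card]
    omega

/-- The `ρ`-path from `x` to `y` meets no element of `hd` before `y`, so `π` follows it too. It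
transports a vertex of the tree into the glued map. -/
theorem Equiv.Perm.SameCycle.of_agree {X : Type*} [Finite X] {π ρ : Equiv.Perm X} {hd : X → Prop}
    (hag : ∀ x, ¬ hd x → π x = ρ x) (hu : ∀ a b, hd a → hd b → ρ.SameCycle a b → a = b)
    {x y : X} (hy : hd y) (h : ρ.SameCycle x y) : π.SameCycle x y := by
  obtain ⟨k, hk⟩ := h.exists_nat_pow_eq
  induction k generalizing x with
  | zero => rw [← hk]; exact .refl _ _
  | succ k ih =>
    by_cases hx : hd x
    · rw [hu x y hx hy h]
    · have h1 : π.SameCycle (ρ x) y := ih (Equiv.Perm.sameCycle_apply_left.2 h) (by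
        rwa [← Equiv.Perm.mul_apply, ← pow_succ])
      rw [← hag x hx] at h1
      exact Equiv.Perm.sameCycle_apply_left.1 h1

theorem Equiv.Perm.SameCycle.closed {X : Type*} [Finite X] {π : Equiv.Perm X} {Q : X → Prop}
    (hQ : ∀ x, Q x → Q (π x)) {x y : X} (h : π.SameCycle x y) (hx : Q x) : Q y := by
  obtain ⟨k, rfl⟩ := h.exists_nat_pow_eq
  clear h
  induction k with
  | zero => exact hx
  | succ k ih => rw [pow_succ', Equiv.Perm.mul_apply]; exact hQ _ ih

namespace RotationSystem

variable {n : ℕ}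

theorem tourSum_add (T : RotationSystem n) (F G : Fin (n + 1) → ℚ) (x : Fin (2 * n + 1)) :
    T.tourSum (F + G) x = T.tourSum F x + T.tourSum G x := by
  simp only [tourSum, Pi.add_apply]
  rw [← sum_add_distrib]
  exact sum_congr rfl fun b _ => by split_ifs <;> simp

theorem tourSum_smul (T : RotationSystem n) (c : ℚ) (F : Fin (n + 1) → ℚ)
    (x : Fin (2 * n + 1)) : T.tourSum (c • F) x = c * T.tourSum F x := by
  simp only [tourSum, Pi.smul_apply, smul_eq_mul]
  rw [mul_sum]
  exact sum_congr rfl fun b _ => by split_ifs <;> simp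

/-! ### Gluing a tree along a non-crossing partition gives a planar map. -/

section Glue

variable {T : RotationSystem n} (hT : T.IsTree) (s : Setoid (Fin (n + 1)))

theorem isArborescence_glue : T.IsArborescence (T.glue hT s).isHead := hT.isArborescence_depth

theorem glue_σ_firstCorner (i : Fin (n + 1)) : (T.glue hT s).σ (T.firstCorner i) =
    T.σ (T.firstCorner (inducedPerm (finRotate (n + 1))⁻¹ s i)) :=
  congrArg T.σ (Equiv.Perm.viaEmbedding_apply _ ⟨T.firstCorner, hT.firstCorner_injective⟩ i)

theorem glue_σ_of_tail {x : Fin (2 * n + 1)} (hx : ¬ (T.glue hT s).isHead x) :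
    (T.glue hT s).σ x = T.σ x := by
  refine congrArg T.σ (Equiv.Perm.viaEmbedding_apply_of_notMem _ _ _ fun h => hx ?_)
  exact (hT.exists_firstCorner_iff (isArborescence_glue hT s) x).1 h

/-- The rank of the vertex incident to `x` in the order of appearance. -/
noncomputable def rank (x : Fin (2 * n + 1)) : Fin (n + 1) :=
  (Equiv.ofBijective _ hT.nthVertex_bijective).symm (T.vertex x)

theorem rank_σ (x : Fin (2 * n + 1)) : rank hT (T.σ x) = rank hT x := by
  rw [rank, rank, T.vertex_σ]

theorem rank_firstCorner (i : Fin (n + 1)) : rank hT (T.firstCorner i) = i :=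
  (Equiv.ofBijective _ hT.nthVertex_bijective).symm_apply_apply i

theorem sameCycle_firstCorner_rank (x : Fin (2 * n + 1)) :
    T.σ.SameCycle x (T.firstCorner (rank hT x)) :=
  (T.vertex_eq_iff _ _).1
    ((Equiv.ofBijective _ hT.nthVertex_bijective).apply_symm_apply (T.vertex x)).symm

theorem rank_glue_σ (x : Fin (2 * n + 1)) :
    s (rank hT ((T.glue hT s).σ x)) (rank hT x) := by
  by_cases hx : (T.glue hT s).isHead x
  · obtain ⟨i, rfl⟩ := (hT.exists_firstCorner_iff (isArborescence_glue hT s) x).2 hx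
    rw [glue_σ_firstCorner, rank_σ, rank_firstCorner, rank_firstCorner]
    exact s.symm' (rel_inducedPerm _ s i)
  · rw [glue_σ_of_tail hT s hx, rank_σ]

theorem glue_sameCycle_head {x h : Fin (2 * n + 1)} (hh : (T.glue hT s).isHead h)
    (hx : T.σ.SameCycle x h) : (T.glue hT s).σ.SameCycle x h :=
  hx.of_agree (fun _ => glue_σ_of_tail hT s) (isArborescence_glue hT s).unique_hd hh

/-- Gluing identifies the vertices of each part. -/
theorem glue_sameCycle_iff (x y : Fin (2 * n + 1)) :
    (T.glue hT s).σ.SameCycle x y ↔ s (rank hT x) (rank hT y) := by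
  have hA := isArborescence_glue hT s
  constructor
  · intro h
    exact Quotient.exact (apply_eq_of_sameCycle (f := fun x => Quotient.mk s (rank hT x))
      (fun x => Quotient.sound (rank_glue_σ hT s x)) h)
  · intro h
    have h1 : ∀ z, (T.glue hT s).σ.SameCycle z (T.firstCorner (rank hT z)) := fun z =>
      glue_sameCycle_head hT s (hT.hd_firstCorner hA _) (sameCycle_firstCorner_rank hT z)
    refine (h1 x).trans (.trans ?_ (h1 y).symm)
    refine (sameCycle_inducedPerm_finRotate h).closed
      (Q := fun j => (T.glue hT s).σ.SameCycle (T.firstCorner (rank hT x)) (T.firstCorner j))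
      (fun i hi => hi.trans ?_) (.refl _ _)
    refine .trans (y := (T.glue hT s).σ (T.firstCorner i))
      (Equiv.Perm.sameCycle_apply_right.2 (.refl _ _)) ?_
    rw [glue_σ_firstCorner]
    exact glue_sameCycle_head hT s (hT.hd_firstCorner hA _)
      (Equiv.Perm.sameCycle_apply_left.2 (.refl _ _))

theorem glue_connected : ∀ x y, ∃ g ∈ Subgroup.closure {(T.glue hT s).σ, (T.glue hT s).α},
    g x = y := by
  have hA := isArborescence_glue hT s
  refine (T.glue hT s).toRotationSystem.connected_iff.2 fun Q h0 hσ hα x => ?_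
  have key : ∀ h, (T.glue hT s).isHead h → Q h := by
    refine hA.induct Q h0 fun h g _ hg hs hQ => ?_
    have := (glue_sameCycle_head hT s hg hs).symm.closed hσ hQ
    have h2 := hα _ this
    rwa [show (T.glue hT s).α (T.α h) = h from T.α_α h] at h2
  obtain ⟨h, hh, hs⟩ := hA.exists_hd x
  exact (glue_sameCycle_head hT s hh hs).symm.closed hσ (key h hh)

theorem card_quotient_le_card_vertex_glue :
    Nat.card (Quotient s) ≤ Nat.card (T.glue hT s).Vertex := by
  refine Nat.card_le_card_of_surjective
    (fun v : (T.glue hT s).Vertex => Quotient.lift (fun x => Quotient.mk s (rank hT x))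
      (fun x y h => Quotient.sound ((glue_sameCycle_iff hT s x y).1 h)) v) fun q => ?_
  obtain ⟨i, rfl⟩ := Quotient.exists_rep q
  exact ⟨(T.glue hT s).vertex (T.firstCorner i), congrArg (Quotient.mk s) (rank_firstCorner hT i)⟩

variable {s}

/-- Only heads matter: after the first corner of `i` the glued rotation enters the cyclic
predecessor of `i`, and the sum through the predecessor equals the sum before `i`. -/
theorem tourSum_glue (hs : IsNonCrossing s) {F : Fin (n + 1) → ℚ} (hF : IsBlockFree s F)
    (x : Fin (2 * n + 1)) : T.tourSum F ((T.glue hT s).σ x) = T.tourSum F (T.α x) := by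
  have hA := isArborescence_glue hT s
  by_cases hx : (T.glue hT s).isHead x
  · obtain ⟨i, rfl⟩ := (hT.exists_firstCorner_iff hA x).2 hx
    rw [glue_σ_firstCorner, hT.tourSum_σ_firstCorner hF.sum_eq_zero, hT.tourSum_α_firstCorner]
    convert (hs.sum_lt_eq_sum_le hF (cyclicPred_inducedPerm s i)).symm
  · rw [glue_σ_of_tail hT s hx, hT.tourSum_σ_of_notMem hF.sum_eq_zero]
    exact fun i hi => hx ((hT.exists_firstCorner_iff hA x).1 ⟨i, hi⟩)

theorem tourSum_glue_face (hs : IsNonCrossing s) {F : Fin (n + 1) → ℚ} (hF : IsBlockFree s F)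
    (x : Fin (2 * n + 1)) :
    T.tourSum F (Quotient.out ((T.glue hT s).face x)) = T.tourSum F x := by
  refine apply_eq_of_sameCycle (π := (T.glue hT s).facePerm) (fun y => ?_)
    (Quotient.exact (s := Equiv.Perm.SameCycle.setoid (T.glue hT s).facePerm)
      (Quotient.out_eq ((T.glue hT s).face x)))
  have := tourSum_glue hT hs hF (T.α y)
  rwa [T.α_α] at this

/-- The functions `tourSum F + c` live on the faces of the glued map. `F` is recovered from its
jumps at the first corners and `c` from any value, so they span at least n + 1 minus the number of
parts, plus one, dimensions. -/
theorem card_face_glue (hs : IsNonCrossing s) :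
    n + 2 ≤ Nat.card (T.glue hT s).Face + Nat.card (Quotient s) := by
  obtain ⟨K, hK, hcard⟩ := exists_blockFree s
  have := Fintype.ofFinite (T.glue hT s).Face
  let Ψ : (K × ℚ) →ₗ[ℚ] ((T.glue hT s).Face → ℚ) :=
    { toFun := fun p q => T.tourSum p.1 (Quotient.out q) + p.2
      map_add' := fun p q => funext fun f => by
        simp only [Prod.fst_add, Prod.snd_add, Submodule.coe_add, tourSum_add, Pi.add_apply]
        ring
      map_smul' := fun c p => funext fun f => by
        simp only [Prod.smul_fst, Prod.smul_snd, Submodule.coe_smul, tourSum_smul, Pi.smul_apply,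
          smul_eq_mul, RingHom.id_apply]
        ring }
  have hinj : Function.Injective Ψ := by
    refine (injective_iff_map_eq_zero _).2 fun p hp => ?_
    obtain ⟨⟨F, hFK⟩, c⟩ := p
    have hF := hK F hFK
    have h0 : ∀ x, T.tourSum F x + c = 0 := fun x => by
      rw [← tourSum_glue_face hT hs hF]
      exact congrFun hp ((T.glue hT s).face x)
    have hF0 : F = 0 := funext fun a => by
      have h1 := h0 (T.σ (T.firstCorner a))
      have h2 := h0 (T.α (T.firstCorner a))
      rw [hT.tourSum_σ_firstCorner hF.sum_eq_zero] at h1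
      rw [hT.tourSum_α_firstCorner] at h2
      have h3 : (∑ b, if b ≤ a then F b else 0) - (∑ b, if b < a then F b else 0) = F a := by
        rw [← sum_sub_distrib, sum_eq_single a]
        · simp
        · intro b _ hb
          simp only [hb.le_iff_lt, sub_self]
        · exact fun h => absurd (mem_univ a) h
      rw [← h3, Pi.zero_apply]
      linarith
    subst hF0
    have hc := h0 T.root
    simp only [tourSum, Pi.zero_apply, ite_self, sum_const_zero, zero_add] at hc
    subst hc
    rfl
  have h1 := LinearMap.finrank_le_finrank_of_injective hinj
  rw [Module.finrank_prod, Module.finrank_self, Module.finrank_fintype_fun_eq_card,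
    ← Nat.card_eq_fintype_card] at h1
  rw [Fintype.card_fin] at hcard
  omega

theorem isMap_glue (hs : IsNonCrossing s) : (T.glue hT s).IsMap := by
  have hc := glue_connected hT s
  refine ⟨hc, le_antisymm ((T.glue hT s).card_vertex_add_card_face_le hc) ?_⟩
  have h1 := card_face_glue hT hs
  have h2 := card_quotient_le_card_vertex_glue hT s
  omega

end Glue

end RotationSystem

/-! ### The circulation of a directed cycle. -/

namespace OrientedSystem

variable {n : ℕ}

open Classical in
/-- The circulation along the edges with tails `c 0, …, c k`. -/
noncomputable def cycleFlow (M : OrientedSystem n) {k : ℕ} (c : Fin (k + 1) → Fin (2 * n + 1))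
    (x : Fin (2 * n + 1)) : ℚ :=
  ∑ i, ((if x = c i then 1 else 0) - if x = M.α (c i) then 1 else 0)

theorem cycleFlow_α (M : OrientedSystem n) {k : ℕ} (c : Fin (k + 1) → Fin (2 * n + 1))
    (x : Fin (2 * n + 1)) : M.cycleFlow c (M.α x) = - M.cycleFlow c x := by
  rw [cycleFlow, cycleFlow, ← sum_neg_distrib]
  refine sum_congr rfl fun i _ => ?_
  have h1 : M.α x = c i ↔ x = M.α (c i) :=
    ⟨fun h => by rw [← h, M.α_α], fun h => by rw [h, M.α_α]⟩
  simp only [h1, M.α.injective.eq_iff]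
  ring

theorem IsDirectedCycle.sum_mul_cycleFlow {M : OrientedSystem n} {k : ℕ}
    {c : Fin (k + 1) → Fin (2 * n + 1)} (hc : M.IsDirectedCycle c) {u : Fin (2 * n + 1) → ℚ}
    (hu : ∀ x, u (M.σ x) = u x) : ∑ x, u x * M.cycleFlow c x = 0 := by
  simp only [cycleFlow, mul_sum]
  rw [sum_comm]
  have h1 : ∀ i, ∑ x, u x * (((if x = c i then 1 else 0) : ℚ) -
      if x = M.α (c i) then 1 else 0) = u (c i) - u (c (i + 1)) := fun i => by
    have : u (M.α (c i)) = u (c (i + 1)) :=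
      RotationSystem.apply_eq_of_sameCycle hu ((M.vertex_eq_iff _ _).1 (hc.consecutive i))
    simp [mul_sub, this]
  convert_to ∑ i, (u (c i) - u (c (i + 1))) = 0
  · exact sum_congr rfl fun i _ => by rw [← h1 i]
  have h2 := Equiv.sum_comp (Equiv.addRight (1 : Fin (k + 1))) fun i => u (c i)
  simp only [Equiv.coe_addRight] at h2
  rw [sum_sub_distrib, h2, sub_self]

theorem IsDirectedCycle.cycleFlow_nonneg {M : OrientedSystem n} (hM : M.IsOriented) {k : ℕ}
    {c : Fin (k + 1) → Fin (2 * n + 1)} (hc : M.IsDirectedCycle c) {x : Fin (2 * n + 1)}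
    (hx : ¬ M.isHead x) : 0 ≤ M.cycleFlow c x ∧ ∀ i, x = c i → 0 < M.cycleFlow c x := by
  have h1 : ∀ i, x ≠ M.α (c i) := fun i h =>
    hx (h ▸ (hM.isHead_α _ (RotationSystem.ne_root_of_tail hM.root_isHead (hc.tail i))).2 (hc.tail i))
  have h2 : ∀ i, (0 : ℚ) ≤ if x = c i then 1 else 0 := fun i => by split_ifs <;> simp
  have h3 : M.cycleFlow c x = ∑ i, if x = c i then (1 : ℚ) else 0 := by
    rw [cycleFlow]
    exact sum_congr rfl fun i _ => by rw [if_neg (h1 i), sub_zero]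
  rw [h3]
  refine ⟨sum_nonneg fun i _ => h2 i, fun i hi => ?_⟩
  exact sum_pos' (fun i _ => h2 i) ⟨i, mem_univ _, by rw [if_pos hi]; exact one_pos⟩

/-- A function which changes only across the cycle separates its sides. -/
theorem eq_of_eqvGen_avoidStep {M : OrientedSystem n} {k : ℕ} {c : Fin (k + 1) → Fin (2 * n + 1)}
    {w : Fin (2 * n + 1) → ℚ} (hw : ∀ x, w (M.σ x) = w (M.α x))
    (hwα : ∀ x, (∀ i, x ≠ c i ∧ x ≠ M.α (c i)) → w (M.α x) = w x) {x y : Fin (2 * n + 1)}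
    (h : Relation.EqvGen (M.AvoidStep c) x y) : w x = w y := by
  induction h with
  | rel x y h =>
    rcases h with rfl | ⟨rfl, h⟩
    · rw [RotationSystem.facePerm, Equiv.Perm.mul_apply, hw, M.α_α]
    · exact (hwα x h).symm
  | refl => rfl
  | symm _ _ _ ih => exact ih.symm
  | trans _ _ _ _ _ ih1 ih2 => exact ih1.trans ih2

end OrientedSystem

/-! ### Glued maps have no positive cycle. -/

namespace RotationSystem

variable {n : ℕ} {T : RotationSystem n} (hT : T.IsTree) {s : Setoid (Fin (n + 1))}

theorem isOriented_glue (s : Setoid (Fin (n + 1))) : (T.glue hT s).IsOriented :=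
  ⟨(isArborescence_glue hT s).root, (isArborescence_glue hT s).hd_α⟩

/-- A function which does not decrease from the right to the left of the edges is largest at the
root. -/
theorem le_root_of_glue {w : Fin (2 * n + 1) → ℚ}
    (hw : ∀ x, w ((T.glue hT s).σ x) = w (T.α x))
    (hle : ∀ x, ¬ (T.glue hT s).isHead x → w x ≤ w (T.α x)) (x : Fin (2 * n + 1)) :
    w x ≤ w T.root := by
  have hA := isArborescence_glue hT s
  -- Turning counterclockwise past a tail crosses its edge from right to left, so `w` cannot
  -- decrease before the head of the tree vertex is met.
  have h1 : ∀ x h, (T.glue hT s).isHead h → T.σ.SameCycle x h → w x ≤ w h := by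
    intro x h hh hs
    obtain ⟨k, hk⟩ := hs.exists_nat_pow_eq
    induction k generalizing x with
    | zero => rw [← hk]; rfl
    | succ k ih =>
      by_cases hx : (T.glue hT s).isHead x
      · rw [hA.unique_hd x h hx hh hs]
      · have h1 := ih (T.σ x) (Equiv.Perm.sameCycle_apply_left.2 hs) (by
          rwa [← Equiv.Perm.mul_apply, ← pow_succ])
        rw [← glue_σ_of_tail hT s hx, hw] at h1
        exact (hle x hx).trans h1
  have h2 : ∀ h, (T.glue hT s).isHead h → w h ≤ w T.root := by
    refine hA.induct _ le_rfl fun h g hh hg hs ih => ?_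
    by_cases hr : h = T.root
    · rw [hr]
    have ht : ¬ (T.glue hT s).isHead (T.α h) := fun h' => (hA.hd_α h hr).1 h' hh
    -- These two half-edges border the same face, so the walk resumes at the parent without changing
    -- `w`.
    have h3 : w h = w (T.σ (T.α h)) := by
      rw [← glue_σ_of_tail hT s ht, hw, T.α_α]
    rw [h3]
    exact (h1 _ g hg (Equiv.Perm.sameCycle_apply_left.2 hs)).trans ih
  obtain ⟨h, hh, hs⟩ := hA.exists_hd x
  exact (h1 x h hh hs).trans (h2 h hh)

/-- A potential of a directed cycle is maximal at the root; if the root were at the right of the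
cycle, the left side would have a larger value. -/
theorem isTreeOriented_glue (hs : IsNonCrossing s) : (T.glue hT s).IsTreeOriented := by
  have hA := isArborescence_glue hT s
  have hO := isOriented_glue hT s
  have hM := isMap_glue hT hs
  refine ⟨hM, hO, fun v => ?_, fun k c hc hext => ?_⟩
  · have key : ∀ h, (T.glue hT s).isHead h → Relation.ReflTransGen (T.glue hT s).Arc
        ((T.glue hT s).vertex T.root) ((T.glue hT s).vertex h) := by
      refine hA.induct _ .refl fun h g hh hg hgs ih => ?_
      by_cases hr : h = T.root
      · rw [hr]
      refine ih.tail ⟨T.α h, fun h' => (hA.hd_α h hr).1 h' hh, ?_, ?_⟩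
      · exact ((T.glue hT s).vertex_eq_iff _ _).2 (glue_sameCycle_head hT s hg hgs)
      · exact congrArg _ (T.α_α h)
    obtain ⟨x, rfl⟩ := (T.glue hT s).vertex_surjective v
    obtain ⟨h, hh, hx⟩ := hA.exists_hd x
    rw [((T.glue hT s).vertex_eq_iff x h).2 (glue_sameCycle_head hT s hh hx)]
    exact key h hh
  · obtain ⟨w, hw, hf⟩ := hM.exists_cograd ((T.glue hT s).cycleFlow_α c)
      fun u hu => hc.sum_mul_cycleFlow hu
    obtain ⟨i, hi⟩ := hext
    have h1 : w (c i) = w T.root := by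
      refine OrientedSystem.eq_of_eqvGen_avoidStep hw (fun x hx => ?_) hi
      rw [← sub_eq_zero, hf, OrientedSystem.cycleFlow]
      exact sum_eq_zero fun i _ => by rw [if_neg (hx i).1, if_neg (hx i).2, sub_zero]
    have h2 := (hc.cycleFlow_nonneg hO (hc.tail i)).2 i rfl
    have h3 := le_root_of_glue hT hw (fun x hx => by
      have := (hc.cycleFlow_nonneg hO hx).1
      rw [← hf] at this
      exact sub_nonneg.1 this) ((T.glue hT s).α (c i))
    rw [← hf] at h2
    linarith

end RotationSystem

/-! ### First heads and the vertices of the exploded map. -/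

namespace OrientedSystem

variable {n : ℕ}

theorem firstHead_eq_of_forall (M : OrientedSystem n) {x : Fin (2 * n + 1)} {k : ℕ}
    (hk : M.isHead ((M.σ ^ k) x)) (hlt : ∀ j < k, ¬ M.isHead ((M.σ ^ j) x)) :
    M.firstHead x = (M.σ ^ k) x := by
  have : sInf {k : ℕ | M.isHead ((M.σ ^ k) x)} = k :=
    le_antisymm (Nat.sInf_le hk)
      (le_of_not_gt fun h => hlt _ h (Nat.sInf_mem (s := {k : ℕ | M.isHead ((M.σ ^ k) x)}) ⟨k, hk⟩))
  rw [firstHead, this]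

theorem firstHead_of_head (M : OrientedSystem n) {x : Fin (2 * n + 1)} (hx : M.isHead x) :
    M.firstHead x = x :=
  M.firstHead_eq_of_forall (k := 0) hx fun j hj => absurd hj (Nat.not_lt_zero j)

/-- Every vertex is incident to a head. -/
def HasHeads (M : OrientedSystem n) : Prop := ∀ x, ∃ h, M.isHead h ∧ M.σ.SameCycle x h

theorem HasHeads.exists_firstHead {M : OrientedSystem n} (hM : M.HasHeads) (x : Fin (2 * n + 1)) :
    ∃ k : ℕ, M.firstHead x = (M.σ ^ k) x ∧ M.isHead ((M.σ ^ k) x) ∧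
      ∀ j < k, ¬ M.isHead ((M.σ ^ j) x) := by
  obtain ⟨h, hh, hs⟩ := hM x
  obtain ⟨k, rfl⟩ := hs.exists_nat_pow_eq
  exact ⟨_, rfl, Nat.sInf_mem (s := {k : ℕ | M.isHead ((M.σ ^ k) x)}) ⟨k, hh⟩,
    fun j hj => Nat.notMem_of_lt_sInf hj⟩

section HasHeads

variable {M : OrientedSystem n} (hM : M.HasHeads)
include hM

theorem isHead_firstHead (x : Fin (2 * n + 1)) : M.isHead (M.firstHead x) := by
  obtain ⟨k, h1, h2, -⟩ := hM.exists_firstHead x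
  rwa [h1]

theorem sameCycle_firstHead (x : Fin (2 * n + 1)) : M.σ.SameCycle x (M.firstHead x) := by
  obtain ⟨k, h1, -, -⟩ := hM.exists_firstHead x
  rw [h1]
  exact Equiv.Perm.sameCycle_pow_right.2 (.refl _ _)

theorem firstHead_σ {x : Fin (2 * n + 1)} (hx : ¬ M.isHead x) :
    M.firstHead (M.σ x) = M.firstHead x := by
  obtain ⟨k, h1, h2, h3⟩ := hM.exists_firstHead (M.σ x)
  rw [h1]
  have hs : ∀ j, (M.σ ^ j) (M.σ x) = (M.σ ^ (j + 1)) x := fun j => by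
    rw [pow_succ, Equiv.Perm.mul_apply]
  rw [hs] at h2 ⊢
  refine (M.firstHead_eq_of_forall h2 fun j hj => ?_).symm
  rcases j with _ | j
  · exact hx
  · rw [← hs]; exact h3 j (by omega)

theorem explode_σ_of_tail {x : Fin (2 * n + 1)} (hx : ¬ M.isHead x) :
    M.explode.σ x = M.σ x :=
  inducedPerm_eq_of_rel (firstHead_σ hM hx).symm

omit hM in
theorem firstHead_explode_σ (M : OrientedSystem n) (x : Fin (2 * n + 1)) :
    M.firstHead (M.explode.σ x) = M.firstHead x :=
  (rel_inducedPerm M.σ (Setoid.ker M.firstHead) x).symm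

/-- An induction principle along the half-edges that precede a head. -/
theorem firstHead_induction {Q : Fin (2 * n + 1) → Prop} (hhead : ∀ x, M.isHead x → Q x)
    (htail : ∀ x, ¬ M.isHead x → Q (M.σ x) → Q x) (x : Fin (2 * n + 1)) : Q x := by
  obtain ⟨k, -, h2, -⟩ := hM.exists_firstHead x
  induction k generalizing x with
  | zero => exact hhead x h2
  | succ k ih =>
    by_cases hx : M.isHead x
    · exact hhead x hx
    · exact htail x hx (ih (M.σ x) (by rwa [← Equiv.Perm.mul_apply, ← pow_succ]))

theorem explode_sameCycle_firstHead (x : Fin (2 * n + 1)) :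
    M.explode.σ.SameCycle x (M.firstHead x) := by
  refine firstHead_induction hM (Q := fun x => M.explode.σ.SameCycle x (M.firstHead x))
    (fun x hx => ?_) (fun x hx ih => ?_) x
  · rw [M.firstHead_of_head hx]
  · rw [firstHead_σ hM hx, ← explode_σ_of_tail hM hx] at ih
    exact Equiv.Perm.sameCycle_apply_left.1 ih

theorem explode_sameCycle_iff (x y : Fin (2 * n + 1)) :
    M.explode.σ.SameCycle x y ↔ M.firstHead x = M.firstHead y :=
  ⟨fun h => RotationSystem.apply_eq_of_sameCycle M.firstHead_explode_σ h, fun h =>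
    (explode_sameCycle_firstHead hM x).trans (h ▸ (explode_sameCycle_firstHead hM y).symm)⟩

end HasHeads

end OrientedSystem

/-- Agreeing elsewhere, `π` and `ρ` send the elements of `hd` onto the same set; the invariant `f`,
injective on `hd`, tells which image belongs to which element. -/
theorem Equiv.Perm.eq_of_agree {X Y : Type*} {π ρ : Equiv.Perm X} {hd : X → Prop} {f : X → Y}
    (hag : ∀ x, ¬ hd x → π x = ρ x) (hπ : ∀ x, f (π x) = f x) (hρ : ∀ x, f (ρ x) = f x)
    (hf : ∀ a b, hd a → hd b → f a = f b → a = b) : π = ρ := by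
  ext x
  by_cases hx : hd x
  · obtain ⟨y, hy⟩ := π.surjective (ρ x)
    by_cases hyd : hd y
    · rw [← hy, hf y x hyd hx (by rw [← hπ, hy, hρ])]
    · rw [hag y hyd] at hy
      exact absurd (ρ.injective hy ▸ hx) hyd
  · exact hag x hx

/-! ### Exploding a glued map. -/

namespace RotationSystem

variable {n : ℕ}

theorem ext_of_eq {M M' : RotationSystem n} (hσ : M.σ = M'.σ) (hα : M.α = M'.α)
    (hr : M.root = M'.root) : M = M' := by
  cases M
  cases M'
  congr

variable {T : RotationSystem n} (hT : T.IsTree) (s : Setoid (Fin (n + 1)))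

theorem hasHeads_glue : (T.glue hT s).HasHeads := fun x => by
  obtain ⟨h, hh, hx⟩ := (isArborescence_glue hT s).exists_hd x
  exact ⟨h, hh, glue_sameCycle_head hT s hh hx⟩

theorem firstHead_glue (x : Fin (2 * n + 1)) :
    (T.glue hT s).firstHead x = T.firstCorner (rank hT x) := by
  have hA := isArborescence_glue hT s
  refine OrientedSystem.firstHead_induction (hasHeads_glue hT s)
    (Q := fun x => (T.glue hT s).firstHead x = T.firstCorner (rank hT x))
    (fun x hx => ?_) (fun x hx ih => ?_) x
  · rw [OrientedSystem.firstHead_of_head _ hx]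
    exact hA.unique_hd _ _ hx (hT.hd_firstCorner hA _) (sameCycle_firstCorner_rank hT x)
  · rwa [OrientedSystem.firstHead_σ (hasHeads_glue hT s) hx, glue_σ_of_tail hT s hx, rank_σ] at ih

theorem explode_glue : (T.glue hT s).explode = T := by
  have hA := isArborescence_glue hT s
  refine ext_of_eq ?_ rfl rfl
  refine Equiv.Perm.eq_of_agree (hd := (T.glue hT s).isHead) (f := (T.glue hT s).firstHead)
    (fun x hx => ?_) (OrientedSystem.firstHead_explode_σ _) (fun x => ?_) (fun a b ha hb h => ?_)
  · rw [OrientedSystem.explode_σ_of_tail (hasHeads_glue hT s) hx, glue_σ_of_tail hT s hx]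
  · rw [firstHead_glue, firstHead_glue, rank_σ]
  · rwa [OrientedSystem.firstHead_of_head _ ha, OrientedSystem.firstHead_of_head _ hb] at h

theorem explosionPartition_glue : (T.glue hT s).explosionPartition = s := by
  refine Setoid.ext fun i j => ?_
  rw [OrientedSystem.explosionPartition, Setoid.ker_def, explode_glue, vertex_eq_iff,
    glue_sameCycle_iff, rank_firstCorner, rank_firstCorner]

end RotationSystem

/-! ### The exploded map is a tree. -/

/-- A closed walk contains a simple closed walk starting with the same edge. -/
theorem exists_simple_closed_walk {X V : Type*} {p q : X → V} {P : X → Prop} {h : X}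
    (hex : ∃ (k : ℕ) (a : ℕ → X), a 0 = h ∧ a (k + 1) = h ∧
      ∀ i ≤ k, P (a i) ∧ p (a i) = q (a (i + 1))) :
    ∃ (k : ℕ) (a : ℕ → X), a 0 = h ∧ a (k + 1) = h ∧
      (∀ i ≤ k, P (a i) ∧ p (a i) = q (a (i + 1))) ∧
      ∀ i j, i < j → j ≤ k → p (a i) ≠ p (a j) := by
  classical
  obtain ⟨a, h0, h1, h2⟩ := Nat.find_spec hex
  have hmin := fun m => Nat.find_min hex (m := m)
  generalize Nat.find hex = k at *
  refine ⟨k, a, h0, h1, h2, fun i j hij hjk heq => ?_⟩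
  -- In a shortest closed walk, the detour between two visits `i < j` to a vertex could be cut out.
  -- Steps up to `i` are kept, so the first edge survives.
  refine hmin (k - (j - i)) (by omega)
    ⟨fun m => if m ≤ i then a m else a (m + (j - i)), by simp [h0], ?_, fun m hm => ?_⟩
  · beta_reduce
    rw [if_neg (by omega), ← h1]
    congr 1
    omega
  · beta_reduce
    rcases lt_trichotomy m i with hmi | rfl | hmi
    · rw [if_pos hmi.le, if_pos (show m + 1 ≤ i from hmi)]
      exact h2 m (by omega)
    · rw [if_pos le_rfl, if_neg (by omega)]
      refine ⟨(h2 m (by omega)).1, ?_⟩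
      rw [heq, (h2 j hjk).2]
      congr 2
      omega
    · rw [if_neg (by omega), if_neg (by omega), Nat.add_right_comm]
      exact h2 _ (by omega)

namespace OrientedSystem

variable {n : ℕ}

theorem IsTreeOriented.hasHeads {M : OrientedSystem n} (hM : M.IsTreeOriented) : M.HasHeads := by
  intro x
  rcases Relation.ReflTransGen.cases_tail (hM.reachable (M.vertex x)) with h | ⟨u, -, t, ht, -, h⟩
  · exact ⟨M.root, hM.isOriented.root_isHead, (M.vertex_eq_iff _ _).1 h⟩
  · exact ⟨M.α t, (hM.isOriented.isHead_α t
      (RotationSystem.ne_root_of_tail hM.isOriented.root_isHead ht)).2 ht,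
      (M.vertex_eq_iff _ _).1 h.symm⟩

/-- The head of the exploded vertex at the other end of the edge of `h`. -/
noncomputable def parent (M : OrientedSystem n) (h : Fin (2 * n + 1)) : Fin (2 * n + 1) :=
  M.firstHead (M.α h)

/-- A directed cycle of the exploded map, as a set of heads. -/
structure IsParentCycle (M : OrientedSystem n) (P : Fin (2 * n + 1) → Prop) : Prop where
  isHead : ∀ h, P h → M.isHead h
  ne_root : ∀ h, P h → h ≠ M.root
  parent : ∀ h, P h → P (M.parent h)
  surj : ∀ h, P h → ∃ g, P g ∧ M.parent g = h
  periodic : ∃ N, ∀ h, P h → M.parent^[N + 1] h = h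
  trans : ∀ h g, P h → P g → ∃ k, M.parent^[k] h = g
  nonempty : ∃ h, P h

theorem IsOriented.not_isHead_α {M : OrientedSystem n} (hM : M.IsOriented) {h : Fin (2 * n + 1)}
    (hh : M.isHead h) (hr : h ≠ M.root) : ¬ M.isHead (M.α h) :=
  fun h' => (hM.isHead_α h hr).1 h' hh

/-- Either the ancestors of a head of the exploded map contain the root, or there is a cycle. -/
theorem exists_isParentCycle {M : OrientedSystem n} (hH : M.HasHeads)
    {h : Fin (2 * n + 1)} (hh : M.isHead h) (hr : ∀ k, M.parent^[k] h ≠ M.root) :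
    ∃ P, M.IsParentCycle P := by
  obtain ⟨i, j, hne, hij⟩ := Finite.exists_ne_map_eq_of_infinite fun k : ℕ => M.parent^[k] h
  wlog hlt : i < j generalizing i j
  · exact this j i hne.symm hij.symm (by omega)
  have hhead : ∀ k, M.isHead (M.parent^[k] h) := fun k => by
    rcases k with _ | k
    · exact hh
    · rw [Function.iterate_succ_apply']
      exact isHead_firstHead hH _
  have hper : M.parent^[(j - i - 1) + 1] (M.parent^[i] h) = M.parent^[i] h := by
    rw [← Function.iterate_add_apply, show j - i - 1 + 1 + i = j by omega]
    exact hij.symm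
  generalize j - i - 1 = N at hper
  have hper' : ∀ k, M.parent^[N + 1] (M.parent^[k] (M.parent^[i] h)) =
      M.parent^[k] (M.parent^[i] h) := fun k => by
    rw [← Function.iterate_add_apply, Nat.add_comm (N + 1) k, Function.iterate_add_apply, hper]
  have hmul : ∀ m, M.parent^[m * (N + 1)] (M.parent^[i] h) = M.parent^[i] h := fun m => by
    induction m with
    | zero => simp
    | succ m ih => rw [Nat.succ_mul m (N + 1), Function.iterate_add_apply, hper, ih]
  refine ⟨fun y => ∃ k, M.parent^[k] (M.parent^[i] h) = y, ?_, ?_, ?_, ?_, ?_, ?_, ?_⟩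
  · rintro _ ⟨k, rfl⟩
    rw [← Function.iterate_add_apply]
    exact hhead _
  · rintro _ ⟨k, rfl⟩
    rw [← Function.iterate_add_apply]
    exact hr _
  · rintro _ ⟨k, rfl⟩
    exact ⟨k + 1, Function.iterate_succ_apply' _ _ _⟩
  · rintro _ ⟨k, rfl⟩
    refine ⟨_, ⟨k + N, rfl⟩, ?_⟩
    rw [← Function.iterate_succ_apply' M.parent, Nat.succ_eq_add_one, Nat.add_assoc,
      Nat.add_comm k (N + 1),
      Function.iterate_add_apply, hper']
  · refine ⟨N, ?_⟩
    rintro _ ⟨k, rfl⟩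
    exact hper' k
  · rintro _ _ ⟨k, rfl⟩ ⟨l, rfl⟩
    -- From the `k`-th iterate go on to the multiple `k * (N + 1)` of the period, which is the
    -- starting point, then `l` steps further.
    refine ⟨l + (k * (N + 1) - k), ?_⟩
    rw [← Function.iterate_add_apply, Nat.add_assoc,
      Nat.sub_add_cancel (Nat.le_mul_of_pos_right k (by omega)), Function.iterate_add_apply, hmul]
  · exact ⟨_, 0, rfl⟩

namespace IsParentCycle

variable {M : OrientedSystem n} {P : Fin (2 * n + 1) → Prop} (hP : M.IsParentCycle P)
include hP

theorem not_P_α (hO : M.IsOriented) {h : Fin (2 * n + 1)} (hh : P h) : ¬ P (M.α h) := fun h' =>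
  hO.not_isHead_α (hP.isHead h hh) (hP.ne_root h hh) (hP.isHead _ h')

theorem iterate (k : ℕ) {h : Fin (2 * n + 1)} (hh : P h) : P (M.parent^[k] h) := by
  induction k with
  | zero => exact hh
  | succ k ih => rw [Function.iterate_succ_apply']; exact hP.parent _ ih

/-- A potential of which the left side of the cycle is a level set. -/
theorem exists_potential (hM : M.IsMap) (hH : M.HasHeads) (hO : M.IsOriented) :
    ∃ (w : Fin (2 * n + 1) → ℚ) (b : ℚ), (∀ x, w (M.σ x) = w (M.α x)) ∧
      (∀ h, P h → w h = b ∧ w (M.α h) = b - 1) ∧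
      ∀ x, ¬ P x → ¬ P (M.α x) → w (M.α x) = w x := by
  classical
  set f : Fin (2 * n + 1) → ℚ := fun x => (if P (M.α x) then 1 else 0) - if P x then 1 else 0
    with hf
  -- `parent` permutes the cycle, and `M.α h` lies at the vertex of `M.parent h` in `M`: hence as
  -- many edges of the cycle leave each vertex as enter it, and `f` is a circulation.
  have himage : (univ.filter P).image M.parent = univ.filter P := by
    ext y
    simp only [mem_image, mem_filter, mem_univ, true_and]
    exact ⟨fun ⟨x, hx, hxy⟩ => hxy ▸ hP.parent x hx, hP.surj y⟩
  have hinj : Set.InjOn M.parent (univ.filter P : Finset (Fin (2 * n + 1))) :=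
    card_image_iff.1 (congrArg card himage)
  obtain ⟨w, hw, hwf⟩ := hM.exists_cograd (f := f) (fun x => by simp only [hf, M.α_α]; ring)
    (fun u hu => by
      have h1 : ∑ x, u x * (if P (M.α x) then 1 else 0) = ∑ x with P x, u x := by
        rw [← M.sum_α]
        simp only [M.α_α, mul_ite, mul_one, mul_zero]
        rw [← sum_filter]
        conv_rhs => rw [← himage]
        rw [sum_image hinj]
        exact sum_congr rfl fun x _ =>
          RotationSystem.apply_eq_of_sameCycle hu (sameCycle_firstHead hH (M.α x))
      have h2 : ∑ x, u x * (if P x then 1 else 0) = ∑ x with P x, u x := by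
        simp only [mul_ite, mul_one, mul_zero]
        rw [← sum_filter]
      simp only [hf, mul_sub, sum_sub_distrib, h1, h2, sub_self])
  -- Turning past tails never decreases `w`, so `w` is monotone along the cycle of heads, hence
  -- constant on it.
  have hle : ∀ x, w x ≤ w (M.firstHead x) := firstHead_induction hH
    (fun x hx => by rw [M.firstHead_of_head hx]) (fun x hx ih => by
      rw [firstHead_σ hH hx, hw] at ih
      refine le_trans ?_ ih
      rw [← sub_nonneg, hwf]
      simp only [hf, if_neg fun h => hx (hP.isHead x h), sub_zero]
      split_ifs <;> simp)
  have hstep : ∀ h, P h → w h ≤ w (M.parent h) := fun h hh => by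
    have ht := hO.not_isHead_α (hP.isHead h hh) (hP.ne_root h hh)
    have := hle (M.σ (M.α h))
    rwa [hw, M.α_α, firstHead_σ hH ht] at this
  have hiter : ∀ k h, P h → w h ≤ w (M.parent^[k] h) := fun k h hh => by
    induction k with
    | zero => exact le_rfl
    | succ k ih =>
      rw [Function.iterate_succ_apply']
      exact ih.trans (hstep _ (hP.iterate k hh))
  obtain ⟨h0, hh0⟩ := hP.nonempty
  have hconst : ∀ h, P h → w h = w h0 := fun h hh => by
    obtain ⟨k, hk⟩ := hP.trans h h0 hh hh0
    obtain ⟨l, hl⟩ := hP.trans h0 h hh0 hh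
    exact le_antisymm (hk ▸ hiter k h hh) (hl ▸ hiter l h0 hh0)
  refine ⟨w, w h0, hw, fun h hh => ⟨hconst h hh, ?_⟩, fun x hx hxα => ?_⟩
  · have := hwf h
    simp only [hf, if_pos hh, if_neg (hP.not_P_α hO hh)] at this
    rw [← hconst h hh]
    linarith
  · rw [← sub_eq_zero, hwf]
    simp only [hf, if_neg hx, if_neg hxα, sub_self]

/-- The root is not at the left of a cycle of the exploded map. -/
theorem potential_root_ne (hM : M.IsTreeOriented) {w : Fin (2 * n + 1) → ℚ} {b : ℚ}
    (hw : ∀ x, w (M.σ x) = w (M.α x)) (hb : ∀ h, P h → w h = b ∧ w (M.α h) = b - 1)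
    (hx : ∀ x, ¬ P x → ¬ P (M.α x) → w (M.α x) = w x) : w M.root ≠ b := by
  intro hroot
  have hH := hM.hasHeads
  have hO := hM.isOriented
  -- The condition "level `b`, and first head off the cycle" spreads clockwise around vertices of
  -- `M` and along arcs. Starting from the root it would reach every vertex, yet a head of the cycle
  -- violates it.
  have hback : ∀ x, w (M.σ x) = b ∧ ¬ P (M.firstHead (M.σ x)) →
      w x = b ∧ ¬ P (M.firstHead x) := by
    rintro x ⟨h1, h2⟩
    rw [hw] at h1
    by_cases hxh : M.isHead x
    · have hxP : ¬ P x := fun h => by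
        have := (hb x h).2
        rw [h1] at this
        linarith
      have hxα : ¬ P (M.α x) := fun h => by
        have hr : x ≠ M.root := fun hr => hP.ne_root _ h (by rw [hr, M.α_root])
        exact hO.not_isHead_α hxh hr (hP.isHead _ h)
      rw [M.firstHead_of_head hxh, ← hx x hxP hxα]
      exact ⟨h1, hxP⟩
    · rw [firstHead_σ hH hxh] at h2
      have hxα : ¬ P (M.α x) := fun h => h2 (by
        have := hP.parent _ h
        rwa [OrientedSystem.parent, M.α_α] at this)
      rw [← hx x (fun h => hxh (hP.isHead x h)) hxα]
      exact ⟨h1, h2⟩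
  have hcyc : ∀ x y, M.vertex x = M.vertex y → w x = b ∧ ¬ P (M.firstHead x) →
      w y = b ∧ ¬ P (M.firstHead y) := fun x y hxy hgood => by
    refine (Equiv.Perm.sameCycle_inv.2 ((M.vertex_eq_iff x y).1 hxy)).closed
      (Q := fun x => w x = b ∧ ¬ P (M.firstHead x)) (fun z hz => hback _ ?_) hgood
    rwa [show M.σ (M.σ⁻¹ z) = z from M.σ.apply_symm_apply z]
  have key : ∀ v, Relation.ReflTransGen M.Arc (M.vertex M.root) v →
      ∀ x, M.vertex x = v → w x = b ∧ ¬ P (M.firstHead x) := by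
    intro v hv
    induction hv with
    | refl =>
      refine fun x hxv => hcyc _ x hxv.symm ⟨hroot, ?_⟩
      rw [M.firstHead_of_head hO.root_isHead]
      exact fun h => hP.ne_root _ h rfl
    | tail _ harc ih =>
      obtain ⟨t, ht, rfl, rfl⟩ := harc
      obtain ⟨h1, h2⟩ := ih t rfl
      have htα : ¬ P (M.α t) := fun h => h2 (by
        have := hP.parent _ h
        rwa [OrientedSystem.parent, M.α_α] at this)
      have hhd := (hO.isHead_α t (RotationSystem.ne_root_of_tail hO.root_isHead ht)).2 ht
      refine fun x hxv => hcyc _ x hxv.symm ⟨?_, ?_⟩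
      · rw [hx t (fun h => ht (hP.isHead t h)) htα, h1]
      · rwa [M.firstHead_of_head hhd]
  obtain ⟨h0, hh0⟩ := hP.nonempty
  have := (key _ (hM.reachable (M.vertex h0)) h0 rfl).2
  rw [M.firstHead_of_head (hP.isHead h0 hh0)] at this
  exact this hh0

/-- Through every edge of a cycle of the exploded map there is a simple cycle of the map. -/
theorem exists_isDirectedCycle (hH : M.HasHeads) (hO : M.IsOriented) {h : Fin (2 * n + 1)}
    (hh : P h) : ∃ (k : ℕ) (c : Fin (k + 1) → Fin (2 * n + 1)),
      M.IsDirectedCycle c ∧ c 0 = M.α h ∧ ∀ i, P (M.α (c i)) := by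
  obtain ⟨N, hN⟩ := hP.periodic
  obtain ⟨k, a, h0, h1, h2, h3⟩ := exists_simple_closed_walk (h := h) (P := P)
    (p := fun x => M.vertex (M.α x)) (q := M.vertex)
    ⟨N, fun i => M.parent^[i] h, rfl, hN h hh, fun i _ => ⟨hP.iterate i hh, by
      beta_reduce
      rw [Function.iterate_succ_apply']
      exact (M.vertex_eq_iff _ _).2 (sameCycle_firstHead hH _)⟩⟩
  have hPa : ∀ i : Fin (k + 1), P (a i) := fun i => (h2 i (by omega)).1
  have hnext : ∀ j : Fin (k + 1), M.vertex (M.α (a j)) = M.vertex (a ((j + 1 : Fin (k + 1)) : ℕ)) := by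
    intro j
    rw [(h2 j (by omega)).2]
    by_cases hj : j = Fin.last k
    · rw [hj, Fin.last_add_one, Fin.val_zero, Fin.val_last, h0, h1]
    · rw [Fin.val_add_one_of_lt (lt_of_le_of_ne (Fin.le_last j) hj)]
  -- Passing to parents runs against the arrows, so the indices are negated.
  refine ⟨k, fun i => M.α (a ((-i : Fin (k + 1)) : ℕ)), ⟨fun i => ?_, fun i => ?_, ?_⟩, ?_,
    fun i => ?_⟩
  · exact hO.not_isHead_α (hP.isHead _ (hPa _)) (hP.ne_root _ (hPa _))
  · rw [M.α_α, hnext, show -(i + 1) + 1 = -i by abel]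
  · intro i j hij
    refine neg_injective (Fin.ext ?_)
    rcases lt_trichotomy ((-i : Fin (k + 1)) : ℕ) ((-j : Fin (k + 1)) : ℕ) with h | h | h
    · exact absurd hij (h3 _ _ h (by omega))
    · exact h
    · exact absurd hij.symm (h3 _ _ h (by omega))
  · simp [h0]
  · rw [M.α_α]
    exact hPa _

/-- The region of the root in the complement of the cycle borders some edge of the cycle, and not on
the left, where the potential is `b`. So it lies at the right of that edge, and a simple subcycle
through this edge is positive. -/
theorem false_of_isTreeOriented (hM : M.IsTreeOriented) : False := by
  have hH := hM.hasHeads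
  have hO := hM.isOriented
  obtain ⟨w, b, hw, hb, hx⟩ := hP.exists_potential hM.isMap hH hO
  have hroot := hP.potential_root_ne hM hw hb hx
  -- Crossing any edge of `P` is forbidden, which is stronger than avoiding the simple subcycle
  -- chosen later.
  set step : Fin (2 * n + 1) → Fin (2 * n + 1) → Prop := fun x y =>
    y = M.facePerm x ∨ (y = M.α x ∧ ¬ P x ∧ ¬ P (M.α x)) with hstep
  have hwstep : ∀ x y, Relation.EqvGen step x y → w x = w y := by
    intro x y h
    induction h with
    | rel x y h =>
      rcases h with rfl | ⟨rfl, h1, h2⟩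
      · rw [RotationSystem.facePerm, Equiv.Perm.mul_apply, hw, M.α_α]
      · exact (hx x h1 h2).symm
    | refl => rfl
    | symm _ _ _ ih => exact ih.symm
    | trans _ _ _ _ _ ih1 ih2 => exact ih1.trans ih2
  have hside : ∃ y, Relation.EqvGen step y M.root ∧ (P y ∨ P (M.α y)) := by
    by_contra hcon
    push Not at hcon
    have hα : ∀ x, Relation.EqvGen step x M.root → Relation.EqvGen step (M.α x) M.root :=
      fun x h => .trans _ _ _ (.symm _ _ (.rel _ _ (Or.inr ⟨rfl, hcon x h⟩))) h
    have hall := M.connected_iff.1 hM.isMap.connected (fun x => Relation.EqvGen step x M.root)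
      (.refl _) (fun x h => .trans _ _ _ (.symm _ _ (.rel (M.α x) _ (Or.inl (by
        rw [RotationSystem.facePerm, Equiv.Perm.mul_apply, M.α_α])))) (hα x h)) hα
    obtain ⟨h0, hh0⟩ := hP.nonempty
    exact (hcon h0 (hall h0)).1 hh0
  obtain ⟨y, hy, hPy | hPy⟩ := hside
  · exact hroot ((hwstep _ _ hy).symm.trans (hb y hPy).1)
  · obtain ⟨k, c, hc, h0, hcP⟩ := hP.exists_isDirectedCycle hH hO hPy
    rw [M.α_α] at h0
    refine hM.no_positive_cycle k c hc ⟨0, ?_⟩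
    rw [h0]
    refine hy.mono fun x z h => ?_
    refine h.imp_right fun ⟨h1, h2, h3⟩ => ⟨h1, fun i => ⟨fun h => h3 ?_, fun h => h2 ?_⟩⟩
    · rw [h]; exact hcP i
    · rw [h]; exact hcP i

end IsParentCycle

section Explode

variable {M : OrientedSystem n} (hM : M.IsTreeOriented)
include hM

theorem exists_iterate_parent {h : Fin (2 * n + 1)} (hh : M.isHead h) :
    ∃ k, M.parent^[k] h = M.root := by
  by_contra hcon
  push Not at hcon
  obtain ⟨P, hP⟩ := exists_isParentCycle hM.hasHeads hh hcon
  exact hP.false_of_isTreeOriented hM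

theorem isArborescence_explode : M.explode.IsArborescence M.isHead := by
  have hH := hM.hasHeads
  have hO := hM.isOriented
  refine ⟨hO.root_isHead, hO.isHead_α,
    fun x => ⟨_, isHead_firstHead hH x, explode_sameCycle_firstHead hH x⟩,
    fun h g hh hg hs => ?_, fun Q hQ hstep h hh => ?_⟩
  · rwa [explode_sameCycle_iff hH, M.firstHead_of_head hh, M.firstHead_of_head hg] at hs
  · obtain ⟨k, hk⟩ := exists_iterate_parent hM hh
    induction k generalizing h with
    | zero => exact (show h = M.root from hk) ▸ hQ
    | succ k ih =>
      have hp := isHead_firstHead hH (M.α h)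
      exact hstep h (M.parent h) hh hp (explode_sameCycle_firstHead hH _) (ih _ hp hk)

/-- The n + 1 heads lie at distinct vertices and there is at least one face; the genus bound turns
both into equalities. -/
theorem isTree_explode : M.explode.IsTree := by
  classical
  have hA := isArborescence_explode hM
  have hc : ∀ x y, ∃ g ∈ Subgroup.closure {M.explode.σ, M.explode.α}, g x = y := by
    refine M.explode.connected_iff.2 fun Q h0 hσ hα x => ?_
    have key : ∀ h, M.isHead h → Q h := by
      refine hA.induct Q h0 fun h g _ _ hs hQ => ?_
      have h2 := hα _ (hs.symm.closed hσ hQ)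
      rwa [M.explode.α_α] at h2
    obtain ⟨h, hh, hs⟩ := hA.exists_hd x
    exact hs.symm.closed hσ (key h hh)
  have h1 := M.explode.card_vertex_add_card_face_le hc
  have h2 : n + 1 ≤ Nat.card M.explode.Vertex := by
    rw [← M.explode.card_hd hA.root hA.hd_α, ← Nat.card_eq_fintype_card]
    refine Nat.card_le_card_of_injective (fun h : {h // M.isHead h} => M.explode.vertex h.1) ?_
    intro h g hhg
    exact Subtype.ext (hA.unique_hd _ _ h.2 g.2 ((M.explode.vertex_eq_iff _ _).1 hhg))
  have h3 : 0 < Nat.card M.explode.Face :=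
    Nat.card_pos_iff.2 ⟨⟨M.explode.face M.root⟩, inferInstance⟩
  exact ⟨⟨hc, by omega⟩, by omega⟩

end Explode

end OrientedSystem

/-! ### The explosion partition is non-crossing, and gluing undoes explosion. -/

theorem isBlockFree_sub {S : Type*} [Fintype S] [DecidableEq S] {s : Setoid S} {i k : S}
    (h : s i k) :
    IsBlockFree s fun b => ((if b = i then 1 else 0) - if b = k then 1 else 0 : ℚ) := by
  intro u hu
  simp [mul_sub, hu i k h]

namespace OrientedSystem

variable {n : ℕ}

theorem sameCycle_explode_σ (M : OrientedSystem n) (x : Fin (2 * n + 1)) :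
    M.σ.SameCycle x (M.explode.σ x) := by
  obtain ⟨k, -, -, h, -⟩ := inducedFun_spec M.σ (Setoid.ker M.firstHead) x
  change M.σ.SameCycle x (inducedFun M.σ (Setoid.ker M.firstHead) x)
  rw [h]
  exact Equiv.Perm.sameCycle_pow_right.2 (.refl _ _)

theorem explosionPartition_iff (M : OrientedSystem n) (i j : Fin (n + 1)) :
    M.explosionPartition i j ↔
      M.σ.SameCycle (M.explode.firstCorner i) (M.explode.firstCorner j) := by
  rw [explosionPartition, Setoid.ker_def, RotationSystem.vertex_eq_iff]

variable {M : OrientedSystem n} (hM : M.IsTreeOriented)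
include hM

/-- The indicator functions of the parts of the tour between two vertices of a part of the
explosion partition are functions on the faces of the map. -/
theorem tourSum_explode {F : Fin (n + 1) → ℚ} (hF : IsBlockFree M.explosionPartition F)
    (x : Fin (2 * n + 1)) : M.explode.tourSum F (M.σ x) = M.explode.tourSum F (M.α x) := by
  have hT := isTree_explode hM
  have hA := isArborescence_explode hM
  have hH := hM.hasHeads
  have hnot : ∀ {x}, ¬ M.isHead x → ∀ i, M.explode.firstCorner i ≠ x := fun hx i hi =>
    hx ((hT.exists_firstCorner_iff hA _).1 ⟨i, hi⟩)
  set g := M.explode.tourSum F with hg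
  have hgtail : ∀ x, ¬ M.isHead x → g (M.explode.σ x) = g (M.α x) := fun x hx =>
    hT.tourSum_σ_of_notMem hF.sum_eq_zero (hnot hx)
  have hghead : ∀ a, g (M.explode.σ (M.explode.firstCorner a)) -
      g (M.α (M.explode.firstCorner a)) = F a := fun a => by
    have h1 : g (M.explode.σ (M.explode.firstCorner a)) = _ :=
      hT.tourSum_σ_firstCorner hF.sum_eq_zero a
    have h2 : g (M.α (M.explode.firstCorner a)) = _ := hT.tourSum_α_firstCorner F a
    rw [h1, h2, ← sum_sub_distrib, sum_eq_single a]
    · simp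
    · intro b _ hb
      simp only [hb.le_iff_lt, sub_self]
    · exact fun h => absurd (mem_univ a) h
  -- Around a vertex of `M` the jumps of `g` are the values of `F` on one part and sum to zero,
  -- which makes the differences of `g` across edges a circulation.
  obtain ⟨w, hw, hwf⟩ := hM.isMap.exists_cograd (f := fun x => g (M.α x) - g x)
    (fun x => by rw [M.α_α]; ring) (fun u hu => by
      have huE : ∀ x, u (M.explode.σ x) = u x := fun x =>
        (RotationSystem.apply_eq_of_sameCycle hu (M.sameCycle_explode_σ x)).symm
      have h1 : ∑ x, u x * g x = ∑ x, u x * g (M.explode.σ x) := by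
        rw [← Equiv.sum_comp M.explode.σ fun x => u x * g x]
        exact sum_congr rfl fun x _ => by rw [huE]
      have h2 : ∑ a, u (M.explode.firstCorner a) * F a =
          ∑ x, u x * (g (M.explode.σ x) - g (M.α x)) := by
        refine Fintype.sum_of_injective M.explode.firstCorner hT.firstCorner_injective _ _
          (fun x hx => ?_) fun a => by rw [hghead]
        rw [hgtail x fun h => hx ((hT.exists_firstCorner_iff hA x).2 h), sub_self, mul_zero]
      rw [hF (fun a => u (M.explode.firstCorner a)) fun a b hab =>
        RotationSystem.apply_eq_of_sameCycle hu ((M.explosionPartition_iff a b).1 hab)] at h2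
      simp only [mul_sub, sum_sub_distrib] at h2 ⊢
      linarith)
  -- The difference `w - g` is invariant under `α` and under the exploded rotation, hence constant
  -- by connectedness of the tree. So `g` is a face function because `w` is.
  have hzα : ∀ x, w (M.α x) - g (M.α x) = w x - g x := fun x => by linarith [hwf x]
  have hzhead : ∀ x, w x - g x = w (M.firstHead x) - g (M.firstHead x) :=
    firstHead_induction hH (fun x hx => by rw [M.firstHead_of_head hx]) fun x hx ih => by
      rw [firstHead_σ hH hx] at ih
      rw [← ih, ← hzα, hw, ← hgtail x hx, explode_σ_of_tail hH hx]
  have hz := M.explode.eq_root_of_invariant hT.isMap.connected (u := fun x => w x - g x)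
    (fun x => by
      rw [hzhead, M.firstHead_explode_σ, ← hzhead]) hzα
  have h1 := hz (M.σ x)
  have h2 := hz (M.α x)
  beta_reduce at h1 h2
  rw [hw] at h1
  linarith

/-- The head that follows a head around a vertex. -/
theorem exists_next_head (i : Fin (n + 1)) : ∃ j, M.explode.σ (M.explode.firstCorner j) =
    M.σ (M.explode.firstCorner i) := by
  have hT := isTree_explode hM
  have hA := isArborescence_explode hM
  obtain ⟨y, hy⟩ := M.explode.σ.surjective (M.σ (M.explode.firstCorner i))
  by_cases hyd : M.isHead y
  · obtain ⟨j, rfl⟩ := (hT.exists_firstCorner_iff hA y).2 hyd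
    exact ⟨j, hy⟩
  · rw [explode_σ_of_tail hM.hasHeads hyd] at hy
    exact absurd (M.σ.injective hy ▸ hT.hd_firstCorner hA i) hyd

/-- For `F` the indicator of `i` minus that of `k`, the partial sum is the indicator of an interval.
It is read before `a` on one side of a corner and through `b` on the other, whence the shift between
`<` and `≤`. -/
theorem interval_next_head {a b : Fin (n + 1)}
    (hab : M.explode.σ (M.explode.firstCorner b) = M.σ (M.explode.firstCorner a))
    {i k : Fin (n + 1)} (hik : M.explosionPartition i k) (hlt : i < k) :
    (i < a ∧ a ≤ k) ↔ (i ≤ b ∧ b < k) := by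
  have hT := isTree_explode hM
  have hF := isBlockFree_sub hik
  have h1 := tourSum_explode hM hF (M.explode.firstCorner a)
  have h2 : M.explode.tourSum _ (M.α (M.explode.firstCorner a)) = _ :=
    hT.tourSum_α_firstCorner (fun b => ((if b = i then 1 else 0) - if b = k then 1 else 0 : ℚ)) a
  rw [← hab, hT.tourSum_σ_firstCorner hF.sum_eq_zero, h2] at h1
  have key : ∀ p : Fin (n + 1) → Prop, ∀ [DecidablePred p],
      (∑ c, if p c then ((if c = i then 1 else 0) - if c = k then 1 else 0 : ℚ) else 0) =
        (if p i then 1 else 0) - if p k then 1 else 0 := by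
    intro p _
    have : ∀ c, (if p c then ((if c = i then 1 else 0) - if c = k then 1 else 0 : ℚ) else 0) =
        (if c = i then if p i then 1 else 0 else 0) - if c = k then if p k then 1 else 0 else 0 := by
      intro c
      by_cases hi : c = i
      · subst hi; simp [hlt.ne]
      · by_cases hk : c = k
        · subst hk; simp [hi]; split_ifs <;> simp
        · simp [hi, hk]
    simp only [this, sum_sub_distrib, sum_ite_eq', mem_univ, if_true]
  rw [key, key] at h1
  constructor
  · rintro ⟨h3, h4⟩
    rw [if_pos h3, if_neg (not_lt.2 h4)] at h1
    constructor <;> by_contra h5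
    · rw [if_neg h5] at h1
      split_ifs at h1 <;> norm_num at h1
    · rw [if_pos (not_lt.1 h5)] at h1
      split_ifs at h1 <;> norm_num at h1
  · rintro ⟨h3, h4⟩
    rw [if_pos h3, if_neg (not_le.2 h4)] at h1
    constructor <;> by_contra h5
    · rw [if_neg h5] at h1
      split_ifs at h1 <;> norm_num at h1
    · rw [if_pos (not_le.1 h5)] at h1
      split_ifs at h1 <;> norm_num at h1

/-- An element `c` of the part contradicting this is excluded by the interval criterion for the pair
`c, a` if `c < a`, and for the pair `b, c` if `c` exceeds `b ≥ a`. -/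
theorem cyclicPred_next_head {a b : Fin (n + 1)}
    (hab : M.explode.σ (M.explode.firstCorner b) = M.σ (M.explode.firstCorner a)) :
    CyclicPred M.explosionPartition a b := by
  have hs : M.explosionPartition a b := by
    rw [explosionPartition_iff]
    refine .trans (y := M.σ (M.explode.firstCorner a))
      (Equiv.Perm.sameCycle_apply_right.2 (.refl _ _)) ?_
    rw [← hab]
    exact (M.sameCycle_explode_σ _).symm
  refine ⟨hs, ?_⟩
  rcases lt_or_ge b a with h | h
  · exact Or.inl ⟨h, fun c hbc hca hac => absurd
      ((interval_next_head hM hab (Setoid.symm' _ hac) hca).1 ⟨hca, le_rfl⟩).1 (not_le.2 hbc)⟩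
  · refine Or.inr ⟨h, fun c hca hac => ?_, fun c hbc hac => ?_⟩
    · exact absurd ((interval_next_head hM hab (Setoid.symm' _ hac) hca).1 ⟨hca, le_rfl⟩).2
        (not_lt.2 h)
    · exact absurd ((interval_next_head hM hab (Setoid.trans' _ (Setoid.symm' _ hs) hac) hbc).2
        ⟨le_rfl, hbc⟩).1 (not_lt.2 h)

theorem isNonCrossing_explosionPartition : IsNonCrossing M.explosionPartition := by
  classical
  rintro ⟨i, j, k, l, hij, hjk, hkl, hik, hjl, hnij⟩
  -- With `m` the first element of the part of `j` beyond `k`, its predecessor `b` lies in `[j, k)`: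
  -- the interval criterion for `i, k` then puts `m` at most `k`.
  set S := univ.filter fun m => k < m ∧ M.explosionPartition j m with hS
  have hne : S.Nonempty := ⟨l, by simpa [hS] using ⟨hkl, hjl⟩⟩
  have hmS := S.min'_mem hne
  have hmin : ∀ c ∈ S, S.min' hne ≤ c := fun c hc => S.min'_le c hc
  generalize S.min' hne = m at hmS hmin
  obtain ⟨hkm, hjm⟩ := (mem_filter.1 hmS).2
  obtain ⟨b, hb⟩ := exists_next_head hM m
  obtain ⟨hmb, ⟨hbm, hbet⟩ | ⟨-, hbet, -⟩⟩ := cyclicPred_next_head hM hb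
  · have hjb : j ≤ b := le_of_not_gt fun h =>
      hbet j h (hjk.trans hkm) (Setoid.symm' _ hjm)
    have hjb' := Setoid.trans' _ hjm hmb
    have hbk : b < k := by
      refine lt_of_le_of_ne (le_of_not_gt fun h => ?_) fun h => ?_
      · exact absurd (hmin b (mem_filter.2 ⟨mem_univ _, h, hjb'⟩)) (not_le.2 hbm)
      · exact hnij (Setoid.trans' _ hik (Setoid.symm' _ (h ▸ hjb')))
    exact absurd ((interval_next_head hM hb hik (hij.trans hjk)).2 ⟨hij.le.trans hjb, hbk⟩).2
      (not_le.2 hkm)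
  · exact hbet j (hjk.trans hkm) (Setoid.symm' _ hjm)

omit hM in
theorem ext_of_eq {M M' : OrientedSystem n} (h : M.toRotationSystem = M'.toRotationSystem)
    (hd : M.isHead = M'.isHead) : M = M' := by
  cases M
  cases M'
  congr

/-- The orientation is recovered by uniqueness of the arborescence, and the rotation after a head by
uniqueness of the cyclic predecessor. -/
theorem glue_explode : M.explode.glue (isTree_explode hM) M.explosionPartition = M := by
  have hT := isTree_explode hM
  have hA := isArborescence_explode hM
  have hd : (M.explode.glue hT M.explosionPartition).isHead = M.isHead :=
    (RotationSystem.isArborescence_glue hT M.explosionPartition).unique hA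
  refine ext_of_eq (RotationSystem.ext_of_eq (Equiv.ext fun x => ?_) rfl rfl) hd
  by_cases hx : M.isHead x
  · obtain ⟨i, rfl⟩ := (hT.exists_firstCorner_iff hA x).2 hx
    obtain ⟨j, hj⟩ := exists_next_head hM i
    rw [RotationSystem.glue_σ_firstCorner hT,
      (cyclicPred_inducedPerm M.explosionPartition i).unique (cyclicPred_next_head hM hj), hj]
  · rw [RotationSystem.glue_σ_of_tail hT _ (hd ▸ hx), explode_σ_of_tail hM.hasHeads hx]

end OrientedSystem

/-! ### Invariance under relabelling of half-edges. -/

theorem map_pow_of_map {X : Type*} {π ρ : Equiv.Perm X} {e : Equiv.Perm X}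
    (h : ∀ x, e (π x) = ρ (e x)) (k : ℕ) (x : X) : e ((π ^ k) x) = (ρ ^ k) (e x) := by
  induction k with
  | zero => rfl
  | succ k ih => rw [pow_succ', pow_succ', Equiv.Perm.mul_apply, Equiv.Perm.mul_apply, h, ih]

theorem inducedFun_map {X : Type*} {π ρ : Equiv.Perm X} {r s : Setoid X} {e : Equiv.Perm X}
    (h : ∀ x, e (π x) = ρ (e x)) (hrs : ∀ x y, s (e x) (e y) ↔ r x y) (x : X) :
    e (inducedFun π r x) = inducedFun ρ s (e x) := by
  rw [inducedFun, inducedFun, map_pow_of_map h]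
  simp only [← map_pow_of_map h, hrs]

theorem sameCycle_map_iff {X : Type*} {π ρ : Equiv.Perm X} {e : Equiv.Perm X}
    (h : ∀ x, e (π x) = ρ (e x)) (x y : X) : ρ.SameCycle (e x) (e y) ↔ π.SameCycle x y := by
  have : ρ = e * π * e⁻¹ := Equiv.ext fun z => by
    rw [Equiv.Perm.mul_apply, Equiv.Perm.mul_apply, h]
    exact congrArg ρ (e.apply_symm_apply z).symm
  rw [this, Equiv.Perm.sameCycle_conj]
  simp

namespace RotationSystem

variable {n : ℕ} {T T' : RotationSystem n} {e : Equiv.Perm (Fin (2 * n + 1))}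

theorem vertex_map_iff (hσ : ∀ h, e (T.σ h) = T'.σ (e h)) (x y : Fin (2 * n + 1)) :
    T'.vertex (e x) = T'.vertex (e y) ↔ T.vertex x = T.vertex y := by
  rw [vertex_eq_iff, vertex_eq_iff, sameCycle_map_iff hσ]

theorem firstCorner_map (hσ : ∀ h, e (T.σ h) = T'.σ (e h)) (hα : ∀ h, e (T.α h) = T'.α (e h))
    (hr : e T.root = T'.root) (i : Fin (n + 1)) : e (T.firstCorner i) = T'.firstCorner i := by
  have hc : ∀ j, e (T.corner j) = T'.corner j := fun j => by
    have hφ : ∀ x, e (T.facePerm x) = T'.facePerm (e x) := fun x => by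
      rw [facePerm, facePerm, Equiv.Perm.mul_apply, Equiv.Perm.mul_apply, hσ, hα]
    rw [corner, corner, hα, map_pow_of_map hφ, hr]
  have hv : T.IsFirstVisit = T'.IsFirstVisit := funext fun j => propext <|
    forall₂_congr fun i _ => by rw [← hc, ← hc, Ne, Ne, vertex_map_iff hσ]
  rw [firstCorner, firstCorner, hc, hv]

theorem glue_iso (hT : T.IsTree) (hT' : T'.IsTree) (s : Setoid (Fin (n + 1))) (h : T.Iso T') :
    (T.glue hT s).Iso (T'.glue hT' s) := by
  obtain ⟨e, hσ, hα, hr⟩ := h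
  have hfc := firstCorner_map hσ hα hr
  have hd : ∀ x, (T'.glue hT' s).isHead (e x) ↔ (T.glue hT s).isHead x := fun x => by
    rw [← hT.exists_firstCorner_iff (isArborescence_glue hT s),
      ← hT'.exists_firstCorner_iff (isArborescence_glue hT' s)]
    simp only [← hfc, e.injective.eq_iff]
  refine ⟨e, fun x => ?_, hα, hr, hd⟩
  by_cases hx : (T.glue hT s).isHead x
  · obtain ⟨i, rfl⟩ := (hT.exists_firstCorner_iff (isArborescence_glue hT s) x).2 hx
    rw [glue_σ_firstCorner, hσ, hfc, hfc, glue_σ_firstCorner]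
  · rw [glue_σ_of_tail hT s hx, glue_σ_of_tail hT' s fun h => hx ((hd x).1 h), hσ]

end RotationSystem

namespace OrientedSystem

variable {n : ℕ} {M M' : OrientedSystem n}

theorem explode_map {e : Equiv.Perm (Fin (2 * n + 1))} (hσ : ∀ h, e (M.σ h) = M'.σ (e h))
    (hd : ∀ h, M'.isHead (e h) ↔ M.isHead h) (x : Fin (2 * n + 1)) :
    e (M.explode.σ x) = M'.explode.σ (e x) := by
  have hfh : ∀ x, e (M.firstHead x) = M'.firstHead (e x) := fun x => by
    rw [firstHead, firstHead, map_pow_of_map hσ]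
    simp only [← map_pow_of_map hσ, hd]
  refine inducedFun_map hσ (fun x y => ?_) x
  rw [Setoid.ker_def, Setoid.ker_def, ← hfh, ← hfh, e.injective.eq_iff]

theorem Iso.explode (h : M.Iso M') : M.explode.Iso M'.explode := by
  obtain ⟨e, hσ, hα, hr, hd⟩ := h
  exact ⟨e, explode_map hσ hd, hα, hr⟩

theorem Iso.explosionPartition_eq (h : M.Iso M') :
    M.explosionPartition = M'.explosionPartition := by
  obtain ⟨e, hσ, hα, hr, hd⟩ := h
  have hfc : ∀ i, e (M.explode.firstCorner i) = M'.explode.firstCorner i :=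
    RotationSystem.firstCorner_map (explode_map hσ hd) hα hr
  refine Setoid.ext fun i j => ?_
  rw [explosionPartition, explosionPartition, Setoid.ker_def, Setoid.ker_def, ← hfc, ← hfc,
    RotationSystem.vertex_map_iff hσ]

end OrientedSystem

/-! ### The bijection on isomorphism classes. -/

/-- Vertex explosion on classes of tree-oriented maps. -/
noncomputable def explosion (n : ℕ) :
    TreeOrientedMap n → PlaneTree n × NonCrossingPartition (n + 1) :=
  Quotient.lift
    (fun M => (PlaneTree.mk M.1.explode (OrientedSystem.isTree_explode M.2),
      ⟨M.1.explosionPartition, OrientedSystem.isNonCrossing_explosionPartition M.2⟩))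
    fun _ _ h => Prod.ext (Quotient.sound (s := treeSetoid n) (OrientedSystem.Iso.explode h))
      (Subtype.ext (OrientedSystem.Iso.explosionPartition_eq h))

/-- Gluing on classes of trees. -/
noncomputable def gluing (n : ℕ) (p : PlaneTree n × NonCrossingPartition (n + 1)) :
    TreeOrientedMap n :=
  Quotient.lift (s := treeSetoid n)
    (fun T : {T : RotationSystem n // T.IsTree} => TreeOrientedMap.mk (T.1.glue T.2 p.2.1)
      (RotationSystem.isTreeOriented_glue T.2 p.2.2))
    (fun T T' h => Quotient.sound (s := treeOrientedSetoid n)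
      (RotationSystem.glue_iso T.2 T'.2 p.2.1 h)) p.1

theorem gluing_explosion (n : ℕ) (M : TreeOrientedMap n) : gluing n (explosion n M) = M := by
  obtain ⟨⟨M, hM⟩, rfl⟩ := Quotient.exists_rep M
  exact congrArg (Quotient.mk (treeOrientedSetoid n))
    (Subtype.ext (OrientedSystem.glue_explode hM))

theorem explosion_gluing (n : ℕ) (p : PlaneTree n × NonCrossingPartition (n + 1)) :
    explosion n (gluing n p) = p := by
  obtain ⟨T, s, hs⟩ := p
  obtain ⟨⟨T, hT⟩, rfl⟩ := Quotient.exists_rep T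
  exact Prod.ext (congrArg (Quotient.mk (treeSetoid n))
    (Subtype.ext (RotationSystem.explode_glue hT s)))
    (Subtype.ext (RotationSystem.explosionPartition_glue hT s))

theorem mainTheorem3 (n : ℕ) :
    ∃ (hφ₀ : ∀ M : OrientedSystem n, M.IsTreeOriented → M.explode.IsTree)
      (hφ₁ : ∀ M : OrientedSystem n, M.IsTreeOriented → IsNonCrossing M.explosionPartition)
      (hψ : ∀ (T : RotationSystem n) (hT : T.IsTree) (s : Setoid (Fin (n + 1))),
        IsNonCrossing s → (T.glue hT s).IsTreeOriented)
      (φ : TreeOrientedMap n ≃ PlaneTree n × NonCrossingPartition (n + 1)),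
      (∀ (M : OrientedSystem n) (hM : M.IsTreeOriented),
        φ (TreeOrientedMap.mk M hM) =
          (PlaneTree.mk M.explode (hφ₀ M hM), ⟨M.explosionPartition, hφ₁ M hM⟩)) ∧
      (∀ (T : RotationSystem n) (hT : T.IsTree) (s : Setoid (Fin (n + 1)))
        (hs : IsNonCrossing s),
        φ.symm (PlaneTree.mk T hT, ⟨s, hs⟩) =
          TreeOrientedMap.mk (T.glue hT s) (hψ T hT s hs)) :=
  ⟨fun _ => OrientedSystem.isTree_explode,
    fun _ => OrientedSystem.isNonCrossing_explosionPartition,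
    fun _ hT _ => RotationSystem.isTreeOriented_glue hT,
    ⟨explosion n, gluing n, gluing_explosion n, explosion_gluing n⟩,
    fun _ _ => rfl, fun _ _ _ _ => rfl⟩
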